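/- Let $f$ be meromorphic in a domain $U\subseteq\mathbb{C}$, let $k>j\ge 0$ be integers, and suppose that $f^{(j)}\not\equiv 0$. Then there is a constant $C>0$, depending only on $f$, $j$ and $k$, such that for every $0<R<\infty$ with $\overline{D(0,R)}\subset U$ and all $0\le r'<r<R$, $$\int_{r'<|z|<r}\left|\frac{f^{(k)}(z)}{f^{(j)}(z)}\right|^{\frac1{k-j}}dm(z)\;\le\; C\,R\,\log\frac{e(R-r')}{R-r}\,\left(1+\log^+\frac1{R-r}+T^+(R,f)\right);$$ in particular the integral on the left converges. Here $dm$ is the Lebesgue area measure, $T^+(R,f)=\max\{T(R,f),0\}$, and $T(R,f)=m(R,f)+N(R,f)$ is the Nevanlinna characteristic, with $$m(R,f)=\frac1{2\pi}\int_0^{2\pi}\log^+|f(Re^{i\theta})|\,d\theta,\qquad N(R,f)=\sum_{0<|b|\le R}\log\frac{R}{|b|}+n(0,f)\log R,$$ where $b$ runs over the poles of $f$ in $0<|z|\le R$, repeated according to multiplicity, and $n(0,f)\ge 0$ is the multiplicity of the pole of $f$ at the origin ($0$ if there is none). -/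

import Mathlib

open Real Set Filter MeasureTheory Metric

/-- The integrated counting function `N(r, f)` of the poles of `f`, counted with multiplicity:
`N(r, f) = ∑ log (r / |b|) + n(0, f) log r`, where `b` runs over the poles with `0 < |b| ≤ r` and
`n(0, f)` is the multiplicity of the pole at the origin. (The summand `z = 0` of the finite sum
vanishes because `0⁻¹ = 0` and `log 0 = 0`.) This is Mathlib's `ValueDistribution.logCounting f ⊤`,
except that `f` needs to be meromorphic only on the closed disc of radius `r`. -/
noncomputable def discPoleCounting (f : ℂ → ℂ) (r : ℝ) : ℝ :=
  ∑ᶠ z : ℂ, ((MeromorphicOn.divisor f (closedBall 0 |r|))⁻ z : ℝ) * log (r * ‖z‖⁻¹)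
    + ((MeromorphicOn.divisor f (closedBall 0 |r|))⁻ 0 : ℝ) * log r

/-- The Nevanlinna characteristic `T(r, f) = m(r, f) + N(r, f)` of a function that is meromorphic
on the closed disc of radius `r` about the origin, where
`m(r, f) = (2π)⁻¹ ∫₀^{2π} log⁺ |f(r e^{iθ})| dθ`. -/
noncomputable def discCharacteristic (f : ℂ → ℂ) (r : ℝ) : ℝ :=
  circleAverage (fun z ↦ log⁺ ‖f z‖) 0 r + discPoleCounting f r

/-- For functions meromorphic in the plane this is Mathlib's characteristic function. -/
theorem discCharacteristic_eq_characteristic {f : ℂ → ℂ} (hf : Meromorphic f) (r : ℝ) :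
    discCharacteristic f r = ValueDistribution.characteristic f ⊤ r := by
  have h0 : (0 : ℂ) ∈ closedBall (0 : ℂ) |r| := by simp
  have key : ∀ z ∈ closedBall (0 : ℂ) |r|,
      (MeromorphicOn.divisor f (closedBall 0 |r|))⁻ z = (MeromorphicOn.divisor f univ)⁻ z := by
    intro z hz
    rw [Function.locallyFinsuppWithin.negPart_apply, Function.locallyFinsuppWithin.negPart_apply,
      MeromorphicOn.divisor_apply (fun x _ ↦ hf x) hz,
      MeromorphicOn.divisor_apply (fun x _ ↦ hf x) (mem_univ z)]
  simp only [discCharacteristic, discPoleCounting, ValueDistribution.characteristic, Pi.add_apply,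
    ValueDistribution.proximity_top, ValueDistribution.logCounting_top,
    Function.locallyFinsuppWithin.logCounting, AddMonoidHom.coe_mk, ZeroHom.coe_mk, key 0 h0]
  congr 2
  apply finsum_congr
  intro z
  by_cases hz : z ∈ closedBall (0 : ℂ) |r|
  · rw [key z hz, Function.locallyFinsuppWithin.toClosedBall_eval_within _ hz]
  · rw [Function.locallyFinsuppWithin.apply_eq_zero_of_notMem _ hz,
      Function.locallyFinsuppWithin.apply_eq_zero_of_notMem _ hz]

/-!
Write `f_i` for the derivative of `f` of order `i`. If `f_k` vanishes identically, so does the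
integrand. Otherwise no `f_i` with `i ≤ k` vanishes identically, the quotient `f_k / f_j` is the
product of the `k - j` logarithmic derivatives `f_{i+1} / f_i` with `j ≤ i < k`, and the root of order
`k - j` of its modulus is at most the sum of their moduli (`norm_iteratedDeriv_div_rpow_le`). It
remains to bound the area integral of the logarithmic derivative of each `f_i`.

Let `g` be meromorphic on the closed disc of radius `R`. The differentiated Poisson–Jensen formula
bounds `|g' / g|` by the mean of `2R / |ζ - z|²` times `|log |g(ζ)||` over the circle, plus the
logarithmic derivatives of the Blaschke factors of the zeros and poles (`enorm_logDeriv_le`). These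
kernels can be integrated over the annulus directly: `1 / |ζ - z|²` gives at most
`2π log (e (R - r') / (R - r))`, because `(R² - |z|²) / |ζ - z|²` has mean one over circles in the
disc, and a Blaschke factor with zero `a` gives at most a multiple of `R - |a|` times the same
logarithm. The result is `lintegral_annulus_logDeriv_le`, a bound by `R log (e (R - r') / (R - r))` times the
`poissonJensenMass` of `g`, and by Jensen's formula this mass is at most twice the characteristic of
`g` plus constants and a multiple of `log⁺ (1 / R)` (`poissonJensenMass_le`).

To pass from the characteristic of `f_i` to that of `f`, one changes the radius slightly. Since
`log⁺ x ≤ δ x + log⁺ (1 / δ)`, the area estimate over an annulus of width `δ` shows that on one of its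
circles the mean of `log⁺ |g' / g|` is bounded by the mass of `g` and `log⁺ (1 / δ)`
(`exists_circleAverage_posLog_logDeriv_le`). This takes the place of the lemma on the logarithmic
derivative, and induction on `i` gives, for every `s` in `[R / 2, R)`, a radius in `(s, R]` at which
the characteristic of `f_i` is bounded by a multiple of `1 + log⁺ (1 / (R - s)) + T⁺(R, f)`
(`exists_plusCharacteristic_iteratedDeriv_le`). With `s = (R + r) / 2` the theorem follows.

Changing the radius requires a characteristic that is nonnegative and behaves monotonically also for
radii below one; `plusCharacteristic` is the variant used for this.
-/

/-! ### Integration over circles and annuli -/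

/-- The integral of `F` over the circle of radius `t` about the origin with respect to the angle. -/
noncomputable def circleLIntegral (F : ℂ → ENNReal) (t : ℝ) : ENNReal :=
  ∫⁻ θ in Ioo (-π) π, F (circleMap 0 t θ)

/-- The open annulus with radii `r'` and `r` about the origin. -/
def annulus (r' r : ℝ) : Set ℂ := {z : ℂ | r' < ‖z‖ ∧ ‖z‖ < r}

theorem isOpen_annulus (r' r : ℝ) : IsOpen (annulus r' r) :=
  (isOpen_lt continuous_const continuous_norm).inter (isOpen_lt continuous_norm continuous_const)

theorem measurableSet_annulus (r' r : ℝ) : MeasurableSet (annulus r' r) :=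
  (isOpen_annulus r' r).measurableSet

theorem complexPolarCoord_symm_eq_circleMap (p : ℝ × ℝ) :
    Complex.polarCoord.symm p = circleMap 0 p.1 p.2 := by
  rw [Complex.polarCoord_symm_apply, circleMap_zero, Complex.exp_mul_I]
  push_cast
  ring

theorem continuous_circleMap_uncurry : Continuous fun p : ℝ × ℝ ↦ circleMap 0 p.1 p.2 := by
  simp only [circleMap_zero]
  fun_prop

theorem measurable_circleLIntegral {F : ℂ → ENNReal} (hF : Measurable F) :
    Measurable (circleLIntegral F) :=
  (hF.comp continuous_circleMap_uncurry.measurable).lintegral_prod_right'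

/-- Polar coordinates on an annulus. -/
theorem lintegral_annulus {F : ℂ → ENNReal} (hF : Measurable F) {r' r : ℝ} (hr' : 0 ≤ r') :
    ∫⁻ z in annulus r' r, F z = ∫⁻ t in Ioo r' r, ENNReal.ofReal t * circleLIntegral F t := by
  rw [← lintegral_indicator (measurableSet_annulus r' r), ← Complex.lintegral_comp_polarCoord_symm]
  have h1 : ∀ p ∈ polarCoord.target, ENNReal.ofReal p.1 •
      (annulus r' r).indicator F (Complex.polarCoord.symm p) =
      (Ioo r' r ×ˢ univ).indicator
        (fun p : ℝ × ℝ ↦ ENNReal.ofReal p.1 * F (circleMap 0 p.1 p.2)) p := by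
    rintro ⟨t, θ⟩ hp
    have ht : 0 < t := by simpa [polarCoord_target] using hp.1
    rw [complexPolarCoord_symm_eq_circleMap]
    by_cases h : t ∈ Ioo r' r
    · have h' : circleMap 0 t θ ∈ annulus r' r := by
        simpa [annulus, abs_of_pos ht] using h
      simp [h, h']
    · have h' : circleMap 0 t θ ∉ annulus r' r := by
        simpa [annulus, abs_of_pos ht] using h
      simp only [indicator_of_notMem h']
      rw [indicator_of_notMem (by simpa using h)]
      simp
  rw [setLIntegral_congr_fun polarCoord.open_target.measurableSet h1,
    setLIntegral_indicator (measurableSet_Ioo.prod MeasurableSet.univ)]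
  have h2 : (Ioo r' r ×ˢ (univ : Set ℝ)) ∩ polarCoord.target = Ioo r' r ×ˢ Ioo (-π) π := by
    ext ⟨t, θ⟩
    simp only [polarCoord_target, mem_inter_iff, mem_prod, mem_univ, and_true, mem_Ioi]
    constructor
    · rintro ⟨h, -, h'⟩
      exact ⟨h, h'⟩
    · rintro ⟨h, h'⟩
      exact ⟨h, hr'.trans_lt h.1, h'⟩
  have hm : Measurable fun p : ℝ × ℝ ↦ ENNReal.ofReal p.1 * F (circleMap 0 p.1 p.2) :=
    (ENNReal.measurable_ofReal.comp measurable_fst).mul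
      (hF.comp continuous_circleMap_uncurry.measurable)
  rw [h2, Measure.volume_eq_prod, setLIntegral_prod _ hm.aemeasurable]
  refine lintegral_congr fun t ↦ ?_
  dsimp only [circleLIntegral]
  exact lintegral_const_mul (f := fun θ ↦ F (circleMap 0 t θ)) _
    (hF.comp (continuous_circleMap 0 t).measurable)

theorem circleAverage_eq_integral_Ioo {E : Type*} [NormedAddCommGroup E] [NormedSpace ℝ E]
    (f : ℂ → E) (t : ℝ) :
    circleAverage f 0 t = (2 * π)⁻¹ • ∫ θ in Ioo (-π) π, f (circleMap 0 t θ) := by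
  rw [circleAverage_eq_integral_add (-π), ← integral_Ioc_eq_integral_Ioo,
    ← intervalIntegral.integral_of_le (by linarith [pi_pos]),
    intervalIntegral.integral_comp_add_right (fun θ ↦ f (circleMap 0 t θ))]
  congr 2 <;> ring

theorem enorm_circleAverage_le {E : Type*} [NormedAddCommGroup E] [NormedSpace ℝ E]
    (f : ℂ → E) (t : ℝ) :
    ‖circleAverage f 0 t‖ₑ ≤ ENNReal.ofReal (2 * π)⁻¹ * circleLIntegral (fun z ↦ ‖f z‖ₑ) t := by
  rw [circleAverage_eq_integral_Ioo, enorm_smul, Real.enorm_eq_ofReal (by positivity)]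
  gcongr
  exact enorm_integral_le_lintegral_enorm _

theorem CircleIntegrable.integrableOn_Ioo {E : Type*} [NormedAddCommGroup E] {f : ℂ → E} {t : ℝ}
    (hf : CircleIntegrable f 0 t) :
    IntegrableOn (fun θ ↦ f (circleMap 0 t θ)) (Ioo (-π) π) volume := by
  have h : IntervalIntegrable (fun θ ↦ f (circleMap 0 t θ)) volume (-π) π := by
    refine (((periodic_circleMap 0 t).comp f).intervalIntegrable two_pi_pos.ne'
      (t := 0) ?_) (-π) π
    rw [zero_add]
    exact hf
  exact ((intervalIntegrable_iff_integrableOn_Ioc_of_le (by linarith [pi_pos])).1 h).mono_set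
    Ioo_subset_Ioc_self

theorem circleLIntegral_ofReal {f : ℂ → ℝ} {t : ℝ} (hf : CircleIntegrable f 0 t)
    (h0 : ∀ z ∈ sphere (0 : ℂ) |t|, 0 ≤ f z) :
    circleLIntegral (fun z ↦ ENNReal.ofReal (f z)) t =
      ENNReal.ofReal (2 * π * circleAverage f 0 t) := by
  rw [circleAverage_eq_integral_Ioo, smul_eq_mul, mul_inv_cancel_left₀ two_pi_pos.ne',
    ofReal_integral_eq_lintegral_ofReal hf.integrableOn_Ioo 
      (.of_forall fun θ ↦ h0 _ (circleMap_mem_sphere' 0 t θ))]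
  rfl

/-! ### Area integrals of the kernels -/

/-- The mean over an inner circle of the Poisson kernel, as a function of its pole, is `1`. -/
theorem circleAverage_inv_norm_sub_sq {ζ : ℂ} {t ρ : ℝ} (ht : 0 ≤ t) (htρ : t < ρ)
    (hζ : ‖ζ‖ = ρ) :
    circleAverage (fun z ↦ (‖ζ - z‖ ^ 2)⁻¹) 0 t = (ρ ^ 2 - t ^ 2)⁻¹ := by
  have hne : ∀ z ∈ closedBall (0 : ℂ) |t|, ζ - z ≠ 0 := by
    intro z hz h
    rw [mem_closedBall_zero_iff, abs_of_nonneg ht, ← sub_eq_zero.1 h, hζ] at hz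
    exact absurd hz (not_le.2 htρ)
  have hd : DifferentiableOn ℂ (fun z ↦ (ζ + z) / (ζ - z)) (closedBall 0 |t|) :=
    DifferentiableOn.div (by fun_prop) (by fun_prop) hne
  have h1 : circleAverage (fun z ↦ (ζ + z) / (ζ - z)) 0 t = 1 := by
    rw [DiffContOnCl.circleAverage (hd.mono closure_ball_subset_closedBall).diffContOnCl]
    have : ζ ≠ 0 := by
      rw [← norm_ne_zero_iff, hζ]
      exact (ht.trans_lt htρ).ne'
    simp [this]
  have hci : CircleIntegrable (fun z ↦ (ζ + z) / (ζ - z)) 0 t :=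
    (hd.continuousOn.mono sphere_subset_closedBall).circleIntegrable'
  have h2 := Complex.reCLM.circleAverage_comp_comm hci
  rw [h1, Complex.reCLM_apply, Complex.one_re] at h2
  have hpos : 0 < ρ ^ 2 - t ^ 2 := by nlinarith
  have h3 : circleAverage (Complex.reCLM ∘ fun z ↦ (ζ + z) / (ζ - z)) 0 t =
      circleAverage ((ρ ^ 2 - t ^ 2) • fun z ↦ (‖ζ - z‖ ^ 2)⁻¹) 0 t := by
    refine circleAverage_congr_sphere fun z hz ↦ ?_
    have hz' : ‖z‖ = t := by simpa [abs_of_nonneg ht] using hz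
    have := congrFun (poissonKernel_eq_re_herglotzRieszKernel (c := 0) (w := z)) ζ
    simp only [poissonKernel, Function.comp_apply, herglotzRieszKernel, sub_zero, hζ, hz'] at this
    rw [Function.comp_apply, Complex.reCLM_apply, ← this, Pi.smul_apply, smul_eq_mul,
      div_eq_mul_inv]
  rw [h3, circleAverage_smul, smul_eq_mul] at h2
  exact eq_inv_of_mul_eq_one_right h2

theorem circleLIntegral_inv_norm_sub_sq {ζ : ℂ} {t ρ : ℝ} (ht : 0 ≤ t) (htρ : t < ρ)
    (hζ : ‖ζ‖ = ρ) :
    circleLIntegral (fun z ↦ ENNReal.ofReal (‖ζ - z‖ ^ 2)⁻¹) t =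
      ENNReal.ofReal (2 * π * (ρ ^ 2 - t ^ 2)⁻¹) := by
  rw [circleLIntegral_ofReal _ (fun z _ ↦ by positivity), circleAverage_inv_norm_sub_sq ht htρ hζ]
  refine ContinuousOn.circleIntegrable' (ContinuousOn.inv₀ (by fun_prop) fun z hz h ↦ ?_)
  rw [mem_sphere_zero_iff_norm, abs_of_nonneg ht] at hz
  have : ζ = z := by simpa [sub_eq_zero] using h
  exact htρ.ne (by rw [← hz, ← hζ, this])

theorem measurable_inv_norm_sub_sq (ζ : ℂ) :
    Measurable fun z : ℂ ↦ ENNReal.ofReal (‖ζ - z‖ ^ 2)⁻¹ := by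
  fun_prop

/-- The logarithmic factor of the area estimates, with outer radius `ρ`. -/
noncomputable def annulusLog (ρ r' r : ℝ) : ℝ := log (exp 1 * (ρ - r') / (ρ - r))

theorem annulusLog_eq {ρ r' r : ℝ} (h : r' < r) (hr : r < ρ) :
    annulusLog ρ r' r = 1 + log ((ρ - r') / (ρ - r)) := by
  have : 0 < (ρ - r') / (ρ - r) := div_pos (by linarith) (by linarith)
  rw [annulusLog, mul_div_assoc, log_mul (exp_pos 1).ne' this.ne', log_exp]

theorem one_le_annulusLog {ρ r' r : ℝ} (h : r' < r) (hr : r < ρ) : 1 ≤ annulusLog ρ r' r := by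
  rw [annulusLog_eq h hr]
  have : 0 ≤ log ((ρ - r') / (ρ - r)) :=
    log_nonneg ((one_le_div (by linarith)).2 (by linarith))
  linarith

/-- A point of the outer circle contributes to the area integral at most a multiple of the logarithmic
factor: in polar coordinates the integrand becomes `2 * π * t / (ρ ^ 2 - t ^ 2) ≤ 2 * π / (ρ - t)`. -/
theorem lintegral_annulus_inv_norm_sub_sq_le {ζ : ℂ} {ρ r' r : ℝ} (hr' : 0 ≤ r') (h : r' < r)
    (hr : r < ρ) (hζ : ‖ζ‖ = ρ) :
    ∫⁻ z in annulus r' r, ENNReal.ofReal (‖ζ - z‖ ^ 2)⁻¹ ≤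
      ENNReal.ofReal (2 * π * annulusLog ρ r' r) := by
  rw [lintegral_annulus (measurable_inv_norm_sub_sq ζ) hr']
  have h1 : ∀ t ∈ Ioo r' r, ENNReal.ofReal t *
      circleLIntegral (fun z ↦ ENNReal.ofReal (‖ζ - z‖ ^ 2)⁻¹) t ≤
      ENNReal.ofReal (2 * π * (ρ - t)⁻¹) := by
    intro t ht
    have h0 : 0 < t := hr'.trans_lt ht.1
    have htρ : t < ρ := ht.2.trans hr
    rw [circleLIntegral_inv_norm_sub_sq h0.le htρ hζ, ← ENNReal.ofReal_mul h0.le]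
    apply ENNReal.ofReal_le_ofReal
    have e : ρ ^ 2 - t ^ 2 = (ρ + t) * (ρ - t) := by ring
    have hp : 0 < ρ - t := by linarith
    have : t * (ρ + t)⁻¹ ≤ 1 := by
      rw [← div_eq_mul_inv]
      exact (div_le_one (by linarith)).2 (by linarith)
    calc t * (2 * π * (ρ ^ 2 - t ^ 2)⁻¹) = (t * (ρ + t)⁻¹) * (2 * π * (ρ - t)⁻¹) := by
          rw [e, mul_inv]; ring
      _ ≤ 1 * (2 * π * (ρ - t)⁻¹) := by gcongr
      _ = _ := one_mul _
  have hcont : ContinuousOn (fun t : ℝ ↦ 2 * π * (ρ - t)⁻¹) (uIcc r' r) := by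
    refine continuousOn_const.mul (ContinuousOn.inv₀ (by fun_prop) fun t ht ↦ ?_)
    rw [uIcc_of_le h.le] at ht
    linarith [ht.2]
  have hint := hcont.intervalIntegrable (μ := volume)
  refine (setLIntegral_mono' measurableSet_Ioo h1).trans ?_
  rw [← ofReal_integral_eq_lintegral_ofReal
    (((intervalIntegrable_iff_integrableOn_Ioo_of_le h.le).1 hint))
    ((ae_restrict_iff' measurableSet_Ioo).2 (.of_forall fun t ht ↦ ?_))]
  · apply ENNReal.ofReal_le_ofReal
    rw [← integral_Ioc_eq_integral_Ioo, ← intervalIntegral.integral_of_le h.le,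
      intervalIntegral.integral_const_mul,
      intervalIntegral.integral_comp_sub_left (fun x ↦ x⁻¹) ρ,
      integral_inv_of_pos (by linarith) (by linarith)]
    gcongr
    rw [annulusLog_eq h hr]
    linarith
  · have : 0 < ρ - t := by linarith [ht.2]
    simp only [Pi.zero_apply]
    positivity

theorem lintegral_ball_inv_norm_sub (a : ℂ) (ε : ℝ) :
    ∫⁻ z, (ball a ε).indicator (fun z ↦ ENNReal.ofReal ‖z - a‖⁻¹) z =
      ENNReal.ofReal (2 * π * ε) := by
  have hm : Measurable fun w : ℂ ↦ ENNReal.ofReal ‖w‖⁻¹ := by fun_prop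
  have h1 : ∀ z, (ball a ε).indicator (fun z ↦ ENNReal.ofReal ‖z - a‖⁻¹) z =
      (annulus 0 ε).indicator (fun w ↦ ENNReal.ofReal ‖w‖⁻¹) (z - a) := by
    intro z
    rcases eq_or_ne z a with rfl | hz
    · simp [annulus]
    · have h0 : 0 < ‖z - a‖ := norm_pos_iff.2 (sub_ne_zero.2 hz)
      by_cases h : z ∈ ball a ε
      · rw [indicator_of_mem h, indicator_of_mem
          (show z - a ∈ annulus 0 ε from ⟨h0, mem_ball_iff_norm.1 h⟩)]
      · rw [indicator_of_notMem h, indicator_of_notMem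
          (show z - a ∉ annulus 0 ε from fun h' ↦ h (mem_ball_iff_norm.2 h'.2))]
  simp_rw [h1]
  rw [lintegral_sub_right_eq_self (fun w ↦ (annulus 0 ε).indicator
    (fun w ↦ ENNReal.ofReal ‖w‖⁻¹) w) a, lintegral_indicator (measurableSet_annulus 0 ε),
    lintegral_annulus hm le_rfl]
  have h2 : ∀ t ∈ Ioo 0 ε, ENNReal.ofReal t *
      circleLIntegral (fun w ↦ ENNReal.ofReal ‖w‖⁻¹) t = ENNReal.ofReal (2 * π) := by
    intro t ht
    have hc : circleLIntegral (fun w ↦ ENNReal.ofReal ‖w‖⁻¹) t =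
        ENNReal.ofReal t⁻¹ * ENNReal.ofReal (2 * π) := by
      simp only [circleLIntegral, norm_circleMap_zero, abs_of_pos ht.1]
      rw [setLIntegral_const, Real.volume_Ioo]
      ring_nf
    rw [hc, ← mul_assoc, ← ENNReal.ofReal_mul ht.1.le, mul_inv_cancel₀ ht.1.ne',
      ENNReal.ofReal_one, one_mul]
  rw [setLIntegral_congr_fun measurableSet_Ioo h2, setLIntegral_const, Real.volume_Ioo,
    ← ENNReal.ofReal_mul (by positivity), sub_zero]

theorem norm_sq_sub_conj_mul_sq (ρ : ℝ) (a z : ℂ) :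
    ‖(ρ : ℂ) ^ 2 - starRingEnd ℂ a * z‖ ^ 2 =
      ρ ^ 2 * ‖z - a‖ ^ 2 + (ρ ^ 2 - ‖a‖ ^ 2) * (ρ ^ 2 - ‖z‖ ^ 2) := by
  simp only [← Complex.normSq_eq_norm_sq]
  simp only [Complex.normSq_apply, pow_two, Complex.sub_re, Complex.sub_im, Complex.mul_re,
    Complex.mul_im, Complex.ofReal_re, Complex.ofReal_im, Complex.conj_re, Complex.conj_im]
  ring

theorem mul_norm_sub_le {ρ : ℝ} {a z : ℂ} (hρ : 0 ≤ ρ) (ha : ‖a‖ ≤ ρ) (hz : ‖z‖ ≤ ρ) :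
    ρ * ‖z - a‖ ≤ ‖(ρ : ℂ) ^ 2 - starRingEnd ℂ a * z‖ := by
  refine le_of_sq_le_sq ?_ (norm_nonneg _)
  rw [norm_sq_sub_conj_mul_sq, mul_pow]
  have h1 : 0 ≤ ρ ^ 2 - ‖z‖ ^ 2 := by nlinarith [norm_nonneg z]
  have h2 : 0 ≤ ρ ^ 2 - ‖a‖ ^ 2 := by nlinarith [norm_nonneg a]
  nlinarith [mul_nonneg h2 h1]

theorem exists_norm_eq_norm_sub_eq {a : ℂ} {ρ : ℝ} (ha : ‖a‖ < ρ) :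
    ∃ ζ : ℂ, ‖ζ‖ = ρ ∧ ‖ζ - a‖ = ρ - ‖a‖ := by
  have hρ : 0 < ρ := (norm_nonneg a).trans_lt ha
  have h : (ρ : ℂ) * Complex.exp (a.arg * Complex.I) - a =
      ((ρ - ‖a‖ : ℝ) : ℂ) * Complex.exp (a.arg * Complex.I) := by
    push_cast
    rw [sub_mul, Complex.norm_mul_exp_arg_mul_I]
  refine ⟨ρ * Complex.exp (a.arg * Complex.I), ?_, ?_⟩
  · rw [norm_mul, Complex.norm_exp_ofReal_mul_I, mul_one, Complex.norm_real, norm_eq_abs,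
      abs_of_pos hρ]
  · rw [h, norm_mul, Complex.norm_exp_ofReal_mul_I, mul_one, Complex.norm_real, norm_eq_abs,
      abs_of_pos (sub_pos.2 ha)]

/-- The modulus of the logarithmic derivative at `z` of the Blaschke factor of the disc of radius
`ρ` with zero `a`. -/
noncomputable def blaschkeKernel (ρ : ℝ) (a z : ℂ) : ℝ :=
  (ρ ^ 2 - ‖a‖ ^ 2) / (‖z - a‖ * ‖(ρ : ℂ) ^ 2 - starRingEnd ℂ a * z‖)

/-- With `ζ` the point of the circle nearest to `a`, the kernel is of the size of `1 / ‖z - a‖` on the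
disc about `a` tangent to the circle, and elsewhere of the size of `(ρ - ‖a‖) / ‖ζ - z‖ ^ 2`. -/
theorem blaschkeKernel_le {ρ : ℝ} {a z ζ : ℂ} (ha : ‖a‖ < ρ) (hz : ‖z‖ < ρ) (hζ : ‖ζ‖ = ρ)
    (hζa : ‖ζ - a‖ = ρ - ‖a‖) :
    blaschkeKernel ρ a z ≤ (ball a (ρ - ‖a‖)).indicator (fun z ↦ 2 * ‖z - a‖⁻¹) z +
      8 * (ρ - ‖a‖) * (‖ζ - z‖ ^ 2)⁻¹ := by
  have hρ : 0 < ρ := (norm_nonneg a).trans_lt ha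
  set s := ρ - ‖a‖ with hs
  have hs0 : 0 < s := sub_pos.2 ha
  set d := ‖(ρ : ℂ) ^ 2 - starRingEnd ℂ a * z‖ with hd
  have hnum : ρ ^ 2 - ‖a‖ ^ 2 ≤ 2 * ρ * s := by nlinarith [norm_nonneg a]
  have hnum0 : 0 ≤ ρ ^ 2 - ‖a‖ ^ 2 := by nlinarith [norm_nonneg a]
  have hd1 : ρ * s ≤ d := by
    have h1 : ‖(ρ : ℂ) ^ 2‖ - ‖starRingEnd ℂ a * z‖ ≤ d := norm_sub_norm_le _ _
    rw [norm_mul, RCLike.norm_conj, norm_pow, Complex.norm_real, norm_eq_abs, sq_abs] at h1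
    nlinarith [norm_nonneg a, norm_nonneg z]
  have hd2 : ρ * ‖z - a‖ ≤ d := mul_norm_sub_le hρ.le ha.le hz.le
  have hd0 : 0 < d := lt_of_lt_of_le (by positivity) hd1
  rcases eq_or_ne z a with rfl | hza
  · simp only [blaschkeKernel, sub_self, norm_zero, zero_mul, div_zero]
    have : 0 ≤ (ball z s).indicator (fun w ↦ 2 * ‖w - z‖⁻¹) z :=
      indicator_nonneg (fun _ _ ↦ by positivity) _
    positivity
  have hp : 0 < ‖z - a‖ := norm_pos_iff.2 (sub_ne_zero.2 hza)
  have hζz : 0 < ‖ζ - z‖ := by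
    rw [norm_pos_iff, sub_ne_zero]
    rintro rfl
    exact hz.ne hζ
  rw [blaschkeKernel]
  by_cases hin : z ∈ ball a s
  · rw [indicator_of_mem hin]
    have h2 : (ρ ^ 2 - ‖a‖ ^ 2) / (‖z - a‖ * d) ≤ 2 * ‖z - a‖⁻¹ := by
      rw [div_le_iff₀ (by positivity)]
      calc ρ ^ 2 - ‖a‖ ^ 2 ≤ 2 * (ρ * s) := by linarith
        _ ≤ 2 * d := by gcongr
        _ = 2 * ‖z - a‖⁻¹ * (‖z - a‖ * d) := by field_simp
    have : 0 ≤ 8 * s * (‖ζ - z‖ ^ 2)⁻¹ := by positivity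
    linarith
  · rw [indicator_of_notMem hin, zero_add]
    have hin' : s ≤ ‖z - a‖ := by simpa [dist_eq_norm] using hin
    have h3 : ‖ζ - z‖ ≤ 2 * ‖z - a‖ := by
      calc ‖ζ - z‖ = ‖(ζ - a) - (z - a)‖ := by congr 1; ring
        _ ≤ ‖ζ - a‖ + ‖z - a‖ := norm_sub_le _ _
        _ ≤ 2 * ‖z - a‖ := by linarith
    rw [div_le_iff₀ (by positivity)]
    have h4 : ‖ζ - z‖ ^ 2 ≤ 4 * ‖z - a‖ ^ 2 := by nlinarith
    calc ρ ^ 2 - ‖a‖ ^ 2 ≤ 2 * ρ * s := hnum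
      _ ≤ 2 * ρ * s * (4 * ‖z - a‖ ^ 2 * (‖ζ - z‖ ^ 2)⁻¹) := by
        refine le_mul_of_one_le_right (by positivity) ?_
        rw [← div_eq_mul_inv]
        exact (one_le_div (by positivity)).2 h4
      _ = 8 * s * (‖ζ - z‖ ^ 2)⁻¹ * (‖z - a‖ * (ρ * ‖z - a‖)) := by ring
      _ ≤ 8 * s * (‖ζ - z‖ ^ 2)⁻¹ * (‖z - a‖ * d) := by gcongr

theorem measurable_blaschkeKernel (ρ : ℝ) (a : ℂ) : Measurable (blaschkeKernel ρ a) := by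
  unfold blaschkeKernel
  fun_prop

/-- A zero or pole at `a` contributes to the area integral at most a multiple of its distance
`ρ - ‖a‖` to the circle, up to the logarithmic factor. -/
theorem lintegral_annulus_blaschkeKernel_le {a : ℂ} {ρ r' r : ℝ} (hr' : 0 ≤ r') (h : r' < r)
    (hr : r < ρ) (ha : ‖a‖ < ρ) :
    ∫⁻ z in annulus r' r, ENNReal.ofReal (blaschkeKernel ρ a z) ≤
      ENNReal.ofReal (20 * π * (ρ - ‖a‖) * annulusLog ρ r' r) := by
  obtain ⟨ζ, hζ, hζa⟩ := exists_norm_eq_norm_sub_eq ha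
  have hs0 : 0 < ρ - ‖a‖ := sub_pos.2 ha
  have hL := one_le_annulusLog h hr
  have hind : Measurable ((ball a (ρ - ‖a‖)).indicator fun z ↦ ENNReal.ofReal ‖z - a‖⁻¹) :=
    Measurable.indicator (by fun_prop) measurableSet_ball
  calc ∫⁻ z in annulus r' r, ENNReal.ofReal (blaschkeKernel ρ a z)
      ≤ ∫⁻ z in annulus r' r, (ENNReal.ofReal 2 *
          (ball a (ρ - ‖a‖)).indicator (fun z ↦ ENNReal.ofReal ‖z - a‖⁻¹) z +
          ENNReal.ofReal (8 * (ρ - ‖a‖)) * ENNReal.ofReal (‖ζ - z‖ ^ 2)⁻¹) := by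
        refine setLIntegral_mono' (measurableSet_annulus r' r) fun z hz ↦ ?_
        refine (ENNReal.ofReal_le_ofReal
          (blaschkeKernel_le ha (hz.2.trans hr) hζ hζa)).trans ?_
        refine ENNReal.ofReal_add_le.trans ?_
        rw [← ENNReal.ofReal_mul (by positivity)]
        gcongr
        by_cases hin : z ∈ ball a (ρ - ‖a‖)
        · simp only [indicator_of_mem hin]
          rw [ENNReal.ofReal_mul (by norm_num)]
        · simp [indicator_of_notMem hin]
    _ = ENNReal.ofReal 2 * (∫⁻ z in annulus r' r,
          (ball a (ρ - ‖a‖)).indicator (fun z ↦ ENNReal.ofReal ‖z - a‖⁻¹) z) +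
          ENNReal.ofReal (8 * (ρ - ‖a‖)) *
            ∫⁻ z in annulus r' r, ENNReal.ofReal (‖ζ - z‖ ^ 2)⁻¹ := by
        rw [lintegral_add_left (hind.const_mul _), lintegral_const_mul _ hind,
          lintegral_const_mul _ (measurable_inv_norm_sub_sq ζ)]
    _ ≤ ENNReal.ofReal 2 * ENNReal.ofReal (2 * π * (ρ - ‖a‖)) +
          ENNReal.ofReal (8 * (ρ - ‖a‖)) * ENNReal.ofReal (2 * π * annulusLog ρ r' r) := by
        gcongr
        · exact (setLIntegral_le_lintegral _ _).trans (lintegral_ball_inv_norm_sub a _).le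
        · exact lintegral_annulus_inv_norm_sub_sq_le hr' h hr hζ
    _ ≤ ENNReal.ofReal (20 * π * (ρ - ‖a‖) * annulusLog ρ r' r) := by
        rw [← ENNReal.ofReal_mul (by positivity), ← ENNReal.ofReal_mul (by positivity),
          ← ENNReal.ofReal_add (by positivity) (by positivity)]
        apply ENNReal.ofReal_le_ofReal
        nlinarith [mul_nonneg (mul_nonneg pi_pos.le hs0.le) (sub_nonneg.2 hL)]

/-! ### The differentiated Poisson–Jensen formula -/

open Complex in
theorem norm_logDeriv_canonicalFactor {R : ℝ} {a z : ℂ} (ha : a ∈ ball (0 : ℂ) R)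
    (hz : z ∈ ball (0 : ℂ) R) (hza : z ≠ a) :
    ‖logDeriv (canonicalFactor R a) z‖ = blaschkeKernel R a z := by
  have hR : 0 < R := pos_of_mem_ball ha
  have ha' : ‖a‖ < R := by simpa using ha
  have h0 : canonicalFactor R a z ≠ 0 := canonicalFactor_ne_zero ha (ball_subset_closedBall hz) hza
  rw [canonicalFactor_apply, div_ne_zero_iff] at h0
  have hne : z - a ≠ 0 := sub_ne_zero.2 hza
  have h1 : logDeriv (canonicalFactor R a) z =
      -((R : ℂ) ^ 2 - starRingEnd ℂ a * a) / ((z - a) * (R ^ 2 - starRingEnd ℂ a * z)) := by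
    rw [canonicalFactor_def, logDeriv_div z h0.1 h0.2 (by fun_prop) (by fun_prop),
      logDeriv_const_mul _ _ (by exact_mod_cast hR.ne')]
    have d1 : deriv (fun z ↦ (R : ℂ) ^ 2 - starRingEnd ℂ a * z) z = -starRingEnd ℂ a := by
      simp
    have d2 : deriv (fun z ↦ z - a) z = 1 := by simp
    rw [logDeriv_apply, logDeriv_apply, d1, d2]
    have := h0.1
    field_simp
    ring
  have h2 : (R : ℂ) ^ 2 - starRingEnd ℂ a * a = ((R ^ 2 - ‖a‖ ^ 2 : ℝ) : ℂ) := by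
    rw [← normSq_eq_conj_mul_self, normSq_eq_norm_sq]
    push_cast
    rfl
  rw [h1, norm_div, norm_neg, norm_mul, h2, norm_real, norm_eq_abs, abs_of_nonneg, blaschkeKernel]
  nlinarith [norm_nonneg a]

/-- The part of the canonical decomposition of `g` on the disc of radius `R` that remains after
the Blaschke factors of the zeros and poles in the open disc have been split off: an analytic
function `q` without zeros in the open disc, with `‖g‖ = ‖q‖` on the circle, for which the Poisson
integral of `log ‖g‖` is `log ‖q‖`. Zeros and poles of `g` on the circle are allowed. -/
theorem exists_blaschke_decomposition {g : ℂ → ℂ} {R : ℝ} (hR : 0 < R)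
    (hg : MeromorphicOn g (closedBall 0 R))
    (h'g : ∀ u ∈ closedBall (0 : ℂ) R, meromorphicOrderAt g u ≠ ⊤) :
    ∃ q : ℂ → ℂ, AnalyticOnNhd ℂ q (ball 0 R) ∧ (∀ z ∈ ball (0 : ℂ) R, q z ≠ 0) ∧
      (g =ᶠ[codiscreteWithin (closedBall 0 R)]
        (∏ᶠ u, Complex.canonicalFactor R u ^ (-MeromorphicOn.divisor g (ball 0 R) u)) * q) ∧
      ∀ w ∈ ball (0 : ℂ) R,
        circleAverage ((Complex.re ∘ herglotzRieszKernel 0 w) * fun ζ ↦ log ‖g ζ‖) 0 R =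
          log ‖q w‖ := by
  obtain ⟨h, D⟩ := hg.exists_ecanonicalDecomp fun u ↦ h'g u u.2
  set d := MeromorphicOn.divisor g (sphere 0 R) with hd
  have hfin : d.support.Finite := divisor_sphere_support_finite
  set t := hfin.toFinset with ht
  have hts : ∀ v ∈ t, v ∈ sphere (0 : ℂ) R := by
    intro v hv
    exact d.supportWithinDomain (by simpa [ht] using hv)
  have hprod : (∏ᶠ v, (fun z : ℂ ↦ z - v) ^ d v) = ∏ v ∈ t, (fun z : ℂ ↦ z - v) ^ d v := by
    refine finprod_eq_prod_of_mulSupport_subset _ fun v hv ↦ ?_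
    simp only [ht, Finite.coe_toFinset, Function.mem_support]
    intro h0
    simp [h0] at hv
  -- The factors `z - v` of the zeros and poles `v` on the circle are absorbed into `q`.
  set q : ℂ → ℂ := fun z ↦ (∏ v ∈ t, (z - v) ^ d v) * h z with hq
  have hne : ∀ z, z ∉ t → ∀ v ∈ t, z - v ≠ 0 := by
    intro z hz v hv h0
    exact hz (by rwa [sub_eq_zero.1 h0])
  have hball : ∀ z ∈ ball (0 : ℂ) R, z ∉ t := by
    intro z hz hzt
    have h1 := hts z hzt
    rw [mem_sphere_zero_iff_norm] at h1
    rw [mem_ball_zero_iff] at hz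
    exact hz.ne h1
  have hlog : ∀ z ∈ closedBall (0 : ℂ) R, z ∉ t →
      log ‖q z‖ = ∑ v ∈ t, d v * log ‖z - v‖ + log ‖h z‖ := by
    intro z hz hzt
    rw [hq]
    simp only [norm_mul, norm_prod, norm_zpow]
    rw [log_mul (Finset.prod_ne_zero_iff.2 fun v hv ↦
      zpow_ne_zero _ (norm_ne_zero_iff.2 (hne z hzt v hv))) (norm_ne_zero_iff.2 (D.ne_zero z hz)),
      log_prod fun v hv ↦ zpow_ne_zero _ (norm_ne_zero_iff.2 (hne z hzt v hv))]
    simp [log_zpow]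
  have hgq : g =ᶠ[codiscreteWithin (closedBall 0 R)]
      (∏ᶠ u, Complex.canonicalFactor R u ^ (-MeromorphicOn.divisor g (ball 0 R) u)) * q := by
    filter_upwards [D.eventuallyEq] with z hz
    rw [hz, hprod]
    simp [hq, mul_assoc]
  refine ⟨q, ?_, ?_, hgq, ?_⟩
  · intro z hz
    refine AnalyticAt.mul ?_ (D.analyticOnNhd z (ball_subset_closedBall hz))
    refine Finset.analyticAt_fun_prod _ fun v hv ↦ AnalyticAt.zpow (by fun_prop) ?_
    exact hne z (hball z hz) v hv
  · intro z hz
    exact mul_ne_zero (Finset.prod_ne_zero_iff.2 fun v hv ↦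
      zpow_ne_zero _ (hne z (hball z hz) v hv)) (D.ne_zero z (ball_subset_closedBall hz))
  · intro w hw
    have hfin2 : (MeromorphicOn.divisor g (ball 0 R)).support.Finite :=
      hg.divisor_ball_support_finite
    have hsph : (fun ζ ↦ log ‖g ζ‖) =ᶠ[codiscreteWithin (sphere (0 : ℂ) |R|)]
        ((∑ v ∈ t, fun ζ : ℂ ↦ d v * log ‖ζ - v‖) + fun ζ ↦ log ‖h ζ‖) := by
      rw [abs_of_pos hR]
      filter_upwards [codiscreteWithin_mono sphere_subset_closedBall hgq,
        compl_finite_mem_codiscreteWithin t.finite_toSet, self_mem_codiscreteWithin _]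
        with ζ h1 h2 h3
      rw [h1, Pi.mul_apply, norm_mul]
      -- Blaschke factors have modulus one on the circle.
      have h4 : ‖(∏ᶠ u, Complex.canonicalFactor R u ^
          (-MeromorphicOn.divisor g (ball 0 R) u)) ζ‖ = 1 := by
        rw [finprod_eq_prod_of_mulSupport_subset (s := hfin2.toFinset), Finset.prod_apply,
          norm_prod]
        · refine Finset.prod_eq_one fun u hu ↦ ?_
          have hu' : u ∈ ball (0 : ℂ) R :=
            (MeromorphicOn.divisor g (ball 0 R)).supportWithinDomain (by simpa using hu)
          rw [Pi.pow_apply, norm_zpow, Complex.norm_canonicalFactor_eval_circle_eq_one hu' h3,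
            one_zpow]
        · intro v hv
          simp only [Finite.coe_toFinset, Function.mem_support]
          intro h0
          simp [h0] at hv
      rw [h4, one_mul, hlog ζ (sphere_subset_closedBall h3) (by simpa using h2)]
      simp
    have hker : ContinuousOn (Complex.re ∘ herglotzRieszKernel 0 w) (sphere 0 |R|) :=
      Complex.continuous_re.comp_continuousOn (continuousOn_herglotzRieszKernel_sphere hw)
    have hi1 : ∀ v ∈ t, CircleIntegrable ((Complex.re ∘ herglotzRieszKernel 0 w) *
        fun ζ : ℂ ↦ d v * log ‖ζ - v‖) 0 R := by
      intro v _
      refine CircleIntegrable.continuousOn_mul ?_ hker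
      exact (circleIntegrable_log_norm_sub_const R).const_mul _
    have hi2 : CircleIntegrable ((Complex.re ∘ herglotzRieszKernel 0 w) *
        fun ζ : ℂ ↦ log ‖h ζ‖) 0 R := by
      refine CircleIntegrable.continuousOn_mul ?_ hker
      refine MeromorphicOn.circleIntegrable_log_norm fun z hz ↦ ?_
      rw [abs_of_pos hR] at hz
      exact (D.analyticOnNhd z (sphere_subset_closedBall hz)).meromorphicAt
    have hcongr : ((Complex.re ∘ herglotzRieszKernel 0 w) * fun ζ ↦ log ‖g ζ‖)
        =ᶠ[codiscreteWithin (sphere (0 : ℂ) |R|)]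
        ((∑ v ∈ t, (Complex.re ∘ herglotzRieszKernel 0 w) * fun ζ : ℂ ↦ d v * log ‖ζ - v‖) +
          (Complex.re ∘ herglotzRieszKernel 0 w) * fun ζ ↦ log ‖h ζ‖) := by
      filter_upwards [hsph] with ζ hζ
      simp only [Pi.mul_apply, hζ, Pi.add_apply, Finset.sum_apply, mul_add, Finset.mul_sum]
    rw [circleAverage_congr_codiscreteWithin hcongr hR.ne',
      circleAverage_add (CircleIntegrable.sum _ hi1) hi2, circleAverage_sum hi1,
      hlog w (ball_subset_closedBall hw) (hball w hw)]
    congr 1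
    · refine Finset.sum_congr rfl fun v hv ↦ ?_
      have := circleAverage_re_herglotzRieszKernel_mul_log (hts v hv) hw
      rw [← this, ← smul_eq_mul (d v : ℝ) (circleAverage _ _ _), ← circleAverage_smul]
      congr 1
      ext ζ
      simp only [Pi.mul_apply, Pi.smul_apply, smul_eq_mul]
      ring
    · exact InnerProductSpace.HarmonicOnNhd.circleAverage_re_herglotzRieszKernel_smul
        (fun z hz ↦ (D.analyticOnNhd z hz).harmonicAt_log_norm (D.ne_zero z hz)) hw

/-- If the Poisson integral of `u` is `log ‖q‖`, then the logarithmic derivative of `q` is obtained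
by differentiating the Herglotz kernel. -/
theorem logDeriv_eq_circleAverage_of_poisson {u : ℂ → ℝ} {q : ℂ → ℂ} {R : ℝ}
    (hu : CircleIntegrable u 0 R) (hq : AnalyticOnNhd ℂ q (ball 0 R))
    (hq0 : ∀ z ∈ ball (0 : ℂ) R, q z ≠ 0)
    (hP : ∀ w ∈ ball (0 : ℂ) R,
      circleAverage ((Complex.re ∘ herglotzRieszKernel 0 w) * u) 0 R = log ‖q w‖)
    {z : ℂ} (hz : z ∈ ball (0 : ℂ) R) :
    logDeriv q z = circleAverage (fun ζ ↦ (2 * ζ / (ζ - z) ^ 2) • (u ζ : ℂ)) 0 R := by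
  have hu' : CircleIntegrable (fun ζ ↦ (u ζ : ℂ)) 0 R := by
    simp only [CircleIntegrable, intervalIntegrable_iff] at hu ⊢
    exact Complex.ofRealCLM.integrable_comp hu
  set F : ℂ → ℂ := fun w ↦ circleAverage (fun ζ ↦ herglotzRieszKernel 0 w ζ • (u ζ : ℂ)) 0 R
    with hF
  have hF' : ∀ w ∈ ball (0 : ℂ) R, HasDerivAt F
      (circleAverage (fun ζ ↦ (2 * ζ / (ζ - w) ^ 2) • (u ζ : ℂ)) 0 R) w :=
    fun w hw ↦ hasDerivAt_circleAverage_herglotzRieszKernel_smul hu' hw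
  have hnorm : ∀ w ∈ ball (0 : ℂ) R, ‖Complex.exp (F w) / q w‖ = 1 := by
    intro w hw
    have h1 : (F w).re = log ‖q w‖ := by
      rw [← hP w hw]
      exact re_circleAverage_herglotzRieszKernel_smul hu hw
    have h2 : 0 < ‖q w‖ := norm_pos_iff.2 (hq0 w hw)
    rw [norm_div, Complex.norm_exp, h1, exp_log h2, div_self h2.ne']
  -- `exp F / q` is analytic of modulus one, hence constant.
  have hconst := Complex.eqOn_of_isPreconnected_of_isMaxOn_norm
    (f := fun w ↦ Complex.exp (F w) / q w) (convex_ball (0 : ℂ) R).isPreconnected isOpen_ball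
    (fun w hw ↦ ((hF' w hw).differentiableAt.cexp.div (hq w hw).differentiableAt
      (hq0 w hw)).differentiableWithinAt) hz
    (fun w hw ↦ by simp only [mem_ofPred_eq, Function.comp_apply, hnorm w hw, hnorm z hz, le_refl])
  have hc0 : Complex.exp (F z) / q z ≠ 0 := div_ne_zero (Complex.exp_ne_zero _) (hq0 z hz)
  have heq : q =ᶠ[nhds z] fun w ↦ (Complex.exp (F z) / q z)⁻¹ * Complex.exp (F w) := by
    filter_upwards [isOpen_ball.mem_nhds hz] with w hw
    have h1 : Complex.exp (F w) / q w = Complex.exp (F z) / q z := hconst hw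
    rw [← h1, inv_div, div_mul_cancel₀ _ (Complex.exp_ne_zero _)]
  rw [(logDeriv_congr_nhds heq).self_of_nhds, logDeriv_const_mul _ _ (inv_ne_zero hc0),
    logDeriv_apply, (hF' z hz).cexp.deriv, mul_div_cancel_left₀ _ (Complex.exp_ne_zero _)]

/-- The total mass of the data entering the Poisson–Jensen formula for `g` on the disc of radius
`R`: the mean of `|log ‖g‖|` over the circle, and the zeros and poles in the open disc, counted with
multiplicity and weighted by their relative distance to the circle. -/
noncomputable def poissonJensenMass (g : ℂ → ℂ) (R : ℝ) : ℝ :=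
  circleAverage (fun z ↦ |log ‖g z‖|) 0 R +
    ∑ᶠ u, |(MeromorphicOn.divisor g (ball 0 R) u : ℝ)| * (1 - ‖u‖ / R)

section

variable {g : ℂ → ℂ} {R : ℝ}

theorem finprod_canonicalFactor_eq_prod (hg : MeromorphicOn g (closedBall 0 R)) :
    (∏ᶠ u, Complex.canonicalFactor R u ^ (-MeromorphicOn.divisor g (ball 0 R) u)) =
      ∏ u ∈ hg.divisor_ball_support_finite.toFinset,
        Complex.canonicalFactor R u ^ (-MeromorphicOn.divisor g (ball 0 R) u) := by
  refine finprod_eq_prod_of_mulSupport_subset _ fun v hv ↦ ?_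
  simp only [Finite.coe_toFinset, Function.mem_support]
  intro h0
  simp [h0] at hv

theorem mem_ball_of_mem_divisor_support (hg : MeromorphicOn g (closedBall 0 R)) {u : ℂ}
    (hu : u ∈ hg.divisor_ball_support_finite.toFinset) : u ∈ ball (0 : ℂ) R :=
  (MeromorphicOn.divisor g (ball 0 R)).supportWithinDomain (by simpa using hu)

theorem circleIntegrable_log_norm_of_closedBall (hR : 0 < R)
    (hg : MeromorphicOn g (closedBall 0 R)) : CircleIntegrable (fun ζ ↦ log ‖g ζ‖) 0 R := by
  refine MeromorphicOn.circleIntegrable_log_norm (hg.mono_set ?_)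
  rw [abs_of_pos hR]
  exact sphere_subset_closedBall

theorem circleIntegrable_posLog_norm_of_closedBall (hR : 0 < R)
    (hg : MeromorphicOn g (closedBall 0 R)) : CircleIntegrable (fun ζ ↦ log⁺ ‖g ζ‖) 0 R := by
  refine MeromorphicOn.circleIntegrable_posLog_norm (hg.mono_set ?_)
  rw [abs_of_pos hR]
  exact sphere_subset_closedBall

/-- The estimate of the logarithmic derivative that results from the differentiated
Poisson–Jensen formula. -/
theorem enorm_logDeriv_le (hR : 0 < R) (hg : MeromorphicOn g (closedBall 0 R))
    (h'g : ∀ u ∈ closedBall (0 : ℂ) R, meromorphicOrderAt g u ≠ ⊤) :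
    ∀ᵐ z ∂volume.restrict (ball (0 : ℂ) R),
      ‖logDeriv g z‖ₑ ≤ ENNReal.ofReal (2 * π)⁻¹ * circleLIntegral (fun ζ ↦
          ENNReal.ofReal (2 * R * (‖ζ - z‖ ^ 2)⁻¹) * ENNReal.ofReal |log ‖g ζ‖|) R +
        ∑ u ∈ hg.divisor_ball_support_finite.toFinset, ENNReal.ofReal
          (|(MeromorphicOn.divisor g (ball 0 R) u : ℝ)| * blaschkeKernel R u z) := by
  obtain ⟨q, hq, hq0, hgq, hP⟩ := exists_blaschke_decomposition hR hg h'g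
  have hmem := fun u ↦ mem_ball_of_mem_divisor_support hg (u := u)
  rw [finprod_canonicalFactor_eq_prod hg] at hgq
  set D := MeromorphicOn.divisor g (ball 0 R)
  set t := hg.divisor_ball_support_finite.toFinset
  have hci := circleIntegrable_log_norm_of_closedBall hR hg
  have h1 := logDeriv_congr_codiscreteWithin isOpen_ball
    (hgq.filter_mono (codiscreteWithin_mono ball_subset_closedBall))
  refine ae_restrict_le_codiscreteWithin measurableSet_ball ?_
  filter_upwards [h1, self_mem_codiscreteWithin _, compl_finite_mem_codiscreteWithin t.finite_toSet]
    with z hz hzR hzt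
  have hzt' : ∀ u ∈ t, z ≠ u := by
    rintro u hu rfl
    exact hzt hu
  have hcf : ∀ u ∈ t, AnalyticAt ℂ (Complex.canonicalFactor R u) z ∧
      Complex.canonicalFactor R u z ≠ 0 := fun u hu ↦
    ⟨Complex.analyticOnNhd_canonicalFactor R u z (hzt' u hu),
      Complex.canonicalFactor_ne_zero (hmem u hu) (ball_subset_closedBall hzR) (hzt' u hu)⟩
  have h2 : logDeriv ((∏ u ∈ t, Complex.canonicalFactor R u ^ (-D u)) * q) z =
      ∑ u ∈ t, ((-D u : ℤ) : ℂ) * logDeriv (Complex.canonicalFactor R u) z + logDeriv q z := by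
    have e : ((∏ u ∈ t, Complex.canonicalFactor R u ^ (-D u)) * q) =
        fun w ↦ (∏ u ∈ t, Complex.canonicalFactor R u w ^ (-D u)) * q w := by
      ext w
      simp
    rw [e, logDeriv_mul z (Finset.prod_ne_zero_iff.2 fun u hu ↦ zpow_ne_zero _ (hcf u hu).2)
      (hq0 z hzR) _ (hq z hzR).differentiableAt, logDeriv_prod
        (f := fun u w ↦ Complex.canonicalFactor R u w ^ (-D u))
        (fun u hu ↦ zpow_ne_zero _ (hcf u hu).2)
        (fun u hu ↦ ((hcf u hu).1.fun_zpow (hcf u hu).2).differentiableAt)]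
    · congr 1
      exact Finset.sum_congr rfl fun u hu ↦ logDeriv_fun_zpow (hcf u hu).1.differentiableAt _
    · exact (Finset.analyticAt_fun_prod _ fun u hu ↦
        (hcf u hu).1.fun_zpow (hcf u hu).2).differentiableAt
  rw [hz, h2, logDeriv_eq_circleAverage_of_poisson hci hq hq0 hP hzR, add_comm]
  refine (enorm_add_le _ _).trans (add_le_add ?_ ?_)
  · refine (enorm_circleAverage_le _ _).trans ?_
    gcongr
    refine lintegral_mono fun θ ↦ ?_
    beta_reduce
    rw [enorm_smul, ← ofReal_norm, ← ofReal_norm, Complex.norm_real, norm_eq_abs]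
    gcongr
    rw [norm_div, norm_mul, norm_pow, norm_circleMap_zero, abs_of_pos hR]
    simp [div_eq_mul_inv]
  · refine (enorm_sum_le _ _).trans (Finset.sum_le_sum fun u hu ↦ ?_)
    rw [← ofReal_norm, norm_mul, norm_logDeriv_canonicalFactor (hmem u hu) hzR (hzt' u hu)]
    refine le_of_eq ?_
    congr 2
    rw [Complex.norm_intCast, Int.cast_neg, abs_neg]

/-- The area integral of a logarithmic derivative over an annulus, in terms of Poisson–Jensen data
on a larger circle. -/
theorem lintegral_annulus_logDeriv_le (hg : MeromorphicOn g (closedBall 0 R))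
    (h'g : ∀ u ∈ closedBall (0 : ℂ) R, meromorphicOrderAt g u ≠ ⊤) {r' r : ℝ} (hr' : 0 ≤ r')
    (h : r' < r) (hr : r < R) :
    ∫⁻ z in annulus r' r, ‖logDeriv g z‖ₑ ≤
      ENNReal.ofReal (20 * π * R * annulusLog R r' r * poissonJensenMass g R) := by
  have hR : 0 < R := by linarith
  have hL := one_le_annulusLog h hr
  have hmem := fun u ↦ mem_ball_of_mem_divisor_support hg (u := u)
  have hlog := circleIntegrable_log_norm_of_closedBall hR hg
  have hsub : annulus r' r ⊆ ball (0 : ℂ) R := fun z hz ↦ by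
    rw [mem_ball_zero_iff]
    exact hz.2.trans hr
  have hae := ae_mono (Measure.restrict_mono_set volume hsub) (enorm_logDeriv_le hR hg h'g)
  have hfin := hg.divisor_ball_support_finite
  set D := MeromorphicOn.divisor g (ball 0 R) with hD
  set t := hg.divisor_ball_support_finite.toFinset with ht
  set L := annulusLog R r' r with hLdef
  have hK : Measurable fun p : ℂ × ℝ ↦
      ENNReal.ofReal (2 * R * (‖circleMap 0 R p.2 - p.1‖ ^ 2)⁻¹) := by
    have : Measurable fun p : ℂ × ℝ ↦ circleMap 0 R p.2 :=
      (continuous_circleMap 0 R).measurable.comp measurable_snd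
    fun_prop
  have hu : AEMeasurable (fun θ ↦ ENNReal.ofReal |log ‖g (circleMap 0 R θ)‖|)
      (volume.restrict (Ioo (-π) π)) :=
    (hlog.abs.integrableOn_Ioo.aestronglyMeasurable.aemeasurable).ennreal_ofReal
  have hKu : AEMeasurable (Function.uncurry fun (z : ℂ) (θ : ℝ) ↦
      ENNReal.ofReal (2 * R * (‖circleMap 0 R θ - z‖ ^ 2)⁻¹) *
        ENNReal.ofReal |log ‖g (circleMap 0 R θ)‖|)
      ((volume.restrict (annulus r' r)).prod (volume.restrict (Ioo (-π) π))) :=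
    hK.aemeasurable.mul hu.comp_snd
  have hI1 : ∫⁻ z in annulus r' r, circleLIntegral (fun ζ ↦
      ENNReal.ofReal (2 * R * (‖ζ - z‖ ^ 2)⁻¹) * ENNReal.ofReal |log ‖g ζ‖|) R ≤
      ENNReal.ofReal (2 * R * (2 * π * L)) *
        ENNReal.ofReal (2 * π * circleAverage (fun z ↦ |log ‖g z‖|) 0 R) := by
    have habs : CircleIntegrable (fun ζ ↦ |log ‖g ζ‖|) 0 R := hlog.abs
    rw [← circleLIntegral_ofReal habs fun z _ ↦ abs_nonneg _]
    simp only [circleLIntegral]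
    rw [lintegral_lintegral_swap hKu, ← lintegral_const_mul'' _ hu]
    refine lintegral_mono fun θ ↦ ?_
    rw [lintegral_mul_const' _ _ ENNReal.ofReal_ne_top]
    gcongr
    simp_rw [ENNReal.ofReal_mul (show 0 ≤ 2 * R by positivity)]
    rw [lintegral_const_mul _ (measurable_inv_norm_sub_sq _)]
    gcongr
    refine lintegral_annulus_inv_norm_sub_sq_le hr' h hr ?_
    rw [norm_circleMap_zero, abs_of_pos hR]
  have hI2 : ∀ u ∈ t, ∫⁻ z in annulus r' r,
      ENNReal.ofReal (|(D u : ℝ)| * blaschkeKernel R u z) ≤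
      ENNReal.ofReal (20 * π * R * L * (|(D u : ℝ)| * (1 - ‖u‖ / R))) := by
    intro u hu
    simp_rw [ENNReal.ofReal_mul (abs_nonneg (D u : ℝ))]
    rw [lintegral_const_mul _ (measurable_blaschkeKernel R u).ennreal_ofReal]
    refine (mul_le_mul_right (lintegral_annulus_blaschkeKernel_le hr' h hr
      (mem_ball_zero_iff.1 (hmem u hu))) _).trans (le_of_eq ?_)
    rw [← ENNReal.ofReal_mul (abs_nonneg _), ← hLdef]
    congr 1
    field_simp
  have havg : 0 ≤ circleAverage (fun z ↦ |log ‖g z‖|) 0 R :=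
    circleAverage_nonneg_of_nonneg fun z _ ↦ abs_nonneg _
  have hterm : ∀ u ∈ t, 0 ≤ 20 * π * R * L * (|(D u : ℝ)| * (1 - ‖u‖ / R)) := by
    intro u hu
    have : ‖u‖ / R ≤ 1 := (div_le_one hR).2 (mem_ball_zero_iff.1 (hmem u hu)).le
    have : 0 ≤ 1 - ‖u‖ / R := by linarith
    positivity
  calc ∫⁻ z in annulus r' r, ‖logDeriv g z‖ₑ
      ≤ ∫⁻ z in annulus r' r, (ENNReal.ofReal (2 * π)⁻¹ * circleLIntegral (fun ζ ↦
          ENNReal.ofReal (2 * R * (‖ζ - z‖ ^ 2)⁻¹) * ENNReal.ofReal |log ‖g ζ‖|) R +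
        ∑ u ∈ t, ENNReal.ofReal (|(D u : ℝ)| * blaschkeKernel R u z)) := lintegral_mono_ae hae
    _ = ENNReal.ofReal (2 * π)⁻¹ * (∫⁻ z in annulus r' r, circleLIntegral (fun ζ ↦
          ENNReal.ofReal (2 * R * (‖ζ - z‖ ^ 2)⁻¹) * ENNReal.ofReal |log ‖g ζ‖|) R) +
        ∑ u ∈ t, ∫⁻ z in annulus r' r,
          ENNReal.ofReal (|(D u : ℝ)| * blaschkeKernel R u z) := by
        have hm : ∀ u ∈ t, Measurable fun z ↦
            ENNReal.ofReal (|(D u : ℝ)| * blaschkeKernel R u z) := fun u _ ↦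
          ((measurable_blaschkeKernel R u).const_mul _).ennreal_ofReal
        rw [lintegral_add_right _ (Finset.measurable_fun_sum _ hm), lintegral_finsetSum _ hm,
          lintegral_const_mul' _ _ ENNReal.ofReal_ne_top]
    _ ≤ ENNReal.ofReal (2 * π)⁻¹ * (ENNReal.ofReal (2 * R * (2 * π * L)) *
          ENNReal.ofReal (2 * π * circleAverage (fun z ↦ |log ‖g z‖|) 0 R)) +
        ∑ u ∈ t, ENNReal.ofReal (20 * π * R * L * (|(D u : ℝ)| * (1 - ‖u‖ / R))) := by
        gcongr with u hu
        exact hI2 u hu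
    _ = ENNReal.ofReal (4 * π * R * L * circleAverage (fun z ↦ |log ‖g z‖|) 0 R +
          ∑ u ∈ t, 20 * π * R * L * (|(D u : ℝ)| * (1 - ‖u‖ / R))) := by
        rw [← ENNReal.ofReal_sum_of_nonneg hterm, ← ENNReal.ofReal_mul (by positivity),
          ← ENNReal.ofReal_mul (by positivity), ← ENNReal.ofReal_add (by positivity)
          (Finset.sum_nonneg hterm)]
        congr 2
        field_simp
        ring
    _ ≤ ENNReal.ofReal (20 * π * R * L * poissonJensenMass g R) := by
        apply ENNReal.ofReal_le_ofReal
        rw [poissonJensenMass, finsum_eq_sum_of_support_subset (s := t), mul_add, Finset.mul_sum]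
        · gcongr
          linarith [pi_pos]
        · intro u hu
          simp only [ht, Finite.coe_toFinset, Function.mem_support]
          intro h0
          simp [h0] at hu

end

/-! ### Poisson integrals and the growth of the proximity function -/

section

variable {R : ℝ} {φ : ℂ → ℝ}

theorem re_herglotzRieszKernel_nonneg {w ζ : ℂ} (hw : w ∈ ball (0 : ℂ) R)
    (hζ : ζ ∈ sphere (0 : ℂ) R) : 0 ≤ (herglotzRieszKernel 0 w ζ).re := by
  have h := congrFun (poissonKernel_eq_re_herglotzRieszKernel (c := 0) (w := w)) ζ
  rw [Function.comp_apply] at h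
  rw [← h, poissonKernel, sub_zero, sub_zero, mem_sphere_zero_iff_norm.1 hζ]
  rw [mem_ball_zero_iff] at hw
  exact div_nonneg (by nlinarith [norm_nonneg w]) (by positivity)

theorem CircleIntegrable.re_herglotzRieszKernel_mul (hφ : CircleIntegrable φ 0 R) {w : ℂ}
    (hw : w ∈ ball (0 : ℂ) R) :
    CircleIntegrable ((Complex.re ∘ herglotzRieszKernel 0 w) * φ) 0 R :=
  hφ.continuousOn_mul
    (Complex.continuous_re.comp_continuousOn (continuousOn_herglotzRieszKernel_sphere hw))

/-- The Poisson integral of `φ` is circle integrable on inner circles, and its mean over these is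
the mean of `φ`. -/
theorem circleAverage_poisson (hφ : CircleIntegrable φ 0 R) {t : ℝ} (ht : 0 ≤ t) (htR : t < R) :
    CircleIntegrable
      (fun z ↦ circleAverage ((Complex.re ∘ herglotzRieszKernel 0 z) * φ) 0 R) 0 t ∧
    circleAverage (fun z ↦ circleAverage ((Complex.re ∘ herglotzRieszKernel 0 z) * φ) 0 R) 0 t =
      circleAverage φ 0 R := by
  have hR : 0 < R := ht.trans_lt htR
  set F : ℂ → ℂ := fun w ↦ circleAverage (fun ζ ↦ herglotzRieszKernel 0 w ζ • (φ ζ : ℂ)) 0 R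
  have hφ' : CircleIntegrable (fun ζ ↦ (φ ζ : ℂ)) 0 R := by
    simp only [CircleIntegrable, intervalIntegrable_iff] at hφ ⊢
    exact Complex.ofRealCLM.integrable_comp hφ
  have hF : DifferentiableOn ℂ F (ball 0 R) :=
    differentiableOn_circleAverage_herglotzRieszKernel_smul hφ'
  have hsub : closedBall (0 : ℂ) |t| ⊆ ball 0 R := by
    rw [abs_of_nonneg ht]
    exact closedBall_subset_ball htR
  have hFi : CircleIntegrable F 0 t :=
    (hF.continuousOn.mono (sphere_subset_closedBall.trans hsub)).circleIntegrable'
  have hre : EqOn (Complex.reCLM ∘ F)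
      (fun z ↦ circleAverage ((Complex.re ∘ herglotzRieszKernel 0 z) * φ) 0 R)
      (sphere 0 |t|) := fun z hz ↦
    re_circleAverage_herglotzRieszKernel_smul hφ (hsub (sphere_subset_closedBall hz))
  constructor
  · refine ContinuousOn.circleIntegrable' (ContinuousOn.congr ?_ hre.symm)
    exact Complex.reCLM.continuous.comp_continuousOn
      (hF.continuousOn.mono (sphere_subset_closedBall.trans hsub))
  · rw [← circleAverage_congr_sphere hre, Complex.reCLM.circleAverage_comp_comm hFi,
      DiffContOnCl.circleAverage
        (hF.mono (closure_ball_subset_closedBall.trans hsub)).diffContOnCl, Complex.reCLM_apply,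
      re_circleAverage_herglotzRieszKernel_smul hφ (mem_ball_self hR)]
    refine circleAverage_congr_sphere fun ζ hζ ↦ ?_
    have : ζ ≠ 0 := by
      rintro rfl
      rw [mem_sphere_zero_iff_norm, norm_zero, abs_of_pos hR] at hζ
      exact hR.ne hζ
    change (herglotzRieszKernel 0 0 ζ).re * φ ζ = φ ζ
    simp [herglotzRieszKernel, this]

theorem log_norm_canonicalFactor_nonneg {u z : ℂ} (hu : u ∈ ball (0 : ℂ) R)
    (hz : z ∈ ball (0 : ℂ) R) : 0 ≤ log ‖Complex.canonicalFactor R u z‖ := by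
  have hR : 0 < R := pos_of_mem_ball hu
  rcases eq_or_ne z u with rfl | hzu
  · simp
  · refine log_nonneg ?_
    rw [Complex.canonicalFactor_apply, norm_div, norm_mul, Complex.norm_real, norm_eq_abs,
      abs_of_pos hR, one_le_div (mul_pos hR (norm_pos_iff.2 (sub_ne_zero.2 hzu)))]
    exact mul_norm_sub_le hR.le (mem_ball_zero_iff.1 hu).le (mem_ball_zero_iff.1 hz).le

/-- The mean of the Green function with pole `u` over an inner circle. -/
theorem circleAverage_log_norm_canonicalFactor {u : ℂ} (hu : u ∈ ball (0 : ℂ) R) {t : ℝ}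
    (ht : 0 < t) (htR : t < R) :
    circleAverage (fun z ↦ log ‖Complex.canonicalFactor R u z‖) 0 t =
      log (R / t) - log⁺ (t⁻¹ * ‖u‖) := by
  have hR : 0 < R := ht.trans htR
  have hne : ∀ z ∈ closedBall (0 : ℂ) |t|, (R : ℂ) ^ 2 - starRingEnd ℂ u * z ≠ 0 := by
    intro z hz h
    rw [mem_closedBall_zero_iff, abs_of_pos ht] at hz
    rw [mem_ball_zero_iff] at hu
    have h1 := congrArg norm (sub_eq_zero.1 h)
    rw [norm_mul, RCLike.norm_conj, norm_pow, Complex.norm_real, norm_eq_abs, sq_abs] at h1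
    nlinarith [norm_nonneg u, norm_nonneg z]
  have hf : AnalyticOnNhd ℂ (fun z ↦ (R : ℂ) ^ 2 - starRingEnd ℂ u * z) (closedBall 0 |t|) :=
    fun z _ ↦ by fun_prop
  have h1 : circleAverage (fun z ↦ log ‖(R : ℂ) ^ 2 - starRingEnd ℂ u * z‖) 0 t = 2 * log R := by
    rw [hf.circleAverage_log_norm_of_ne_zero hne]
    simp [log_pow]
  have hi1 : CircleIntegrable (fun z ↦ log ‖(R : ℂ) ^ 2 - starRingEnd ℂ u * z‖) 0 t :=
    (hf.mono sphere_subset_closedBall).meromorphicOn.circleIntegrable_log_norm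
  have hi2 : CircleIntegrable (fun z ↦ log R + log ‖z - u‖) 0 t :=
    (circleIntegrable_const _ _ _).add (circleIntegrable_log_norm_sub_const t)
  have hcongr : (fun z ↦ log ‖Complex.canonicalFactor R u z‖)
      =ᶠ[codiscreteWithin (sphere (0 : ℂ) |t|)]
      (fun z ↦ log ‖(R : ℂ) ^ 2 - starRingEnd ℂ u * z‖) - (fun z ↦ log R + log ‖z - u‖) := by
    filter_upwards [self_mem_codiscreteWithin _,
      compl_finite_mem_codiscreteWithin (finite_singleton u)] with z hz hzu
    have hzu' : z ≠ u := by simpa using hzu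
    have hp : ‖z - u‖ ≠ 0 := norm_ne_zero_iff.2 (sub_ne_zero.2 hzu')
    have h0 := norm_ne_zero_iff.2 (hne z (sphere_subset_closedBall hz))
    rw [Complex.canonicalFactor_apply, norm_div, norm_mul, Complex.norm_real, norm_eq_abs,
      abs_of_pos hR, log_div h0 (mul_ne_zero hR.ne' hp), log_mul hR.ne' hp, Pi.sub_apply]
  rw [circleAverage_congr_codiscreteWithin hcongr ht.ne', circleAverage_sub hi1 hi2, h1,
    circleAverage_fun_add (circleIntegrable_const _ _ _) (circleIntegrable_log_norm_sub_const t),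
    circleAverage_const, circleAverage_log_norm_sub_const_eq_log_radius_add_posLog ht.ne',
    log_div hR.ne' ht.ne']
  simp only [zero_sub, norm_neg]
  ring

variable {g : ℂ → ℂ}

/-- The proximity function on an inner circle is bounded by that on an outer circle plus a
contribution of the poles. -/
theorem circleAverage_posLog_norm_le (hg : MeromorphicOn g (closedBall 0 R))
    (h'g : ∀ u ∈ closedBall (0 : ℂ) R, meromorphicOrderAt g u ≠ ⊤) {t : ℝ} (ht : 0 < t)
    (htR : t < R) :
    circleAverage (fun z ↦ log⁺ ‖g z‖) 0 t ≤ circleAverage (fun z ↦ log⁺ ‖g z‖) 0 R +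
      ∑ u ∈ hg.divisor_ball_support_finite.toFinset,
        ((MeromorphicOn.divisor g (ball 0 R))⁻ u : ℝ) * (log (R / t) - log⁺ (t⁻¹ * ‖u‖)) := by
  have hR : 0 < R := ht.trans htR
  obtain ⟨q, hq, hq0, hgq, hP⟩ := exists_blaschke_decomposition hR hg h'g
  have hmem := fun u ↦ mem_ball_of_mem_divisor_support hg (u := u)
  rw [finprod_canonicalFactor_eq_prod hg] at hgq
  have hlog := circleIntegrable_log_norm_of_closedBall hR hg
  have hplog := circleIntegrable_posLog_norm_of_closedBall hR hg
  set D := MeromorphicOn.divisor g (ball 0 R) with hD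
  set s := hg.divisor_ball_support_finite.toFinset with hs
  set B : ℂ → ℂ := ∏ u ∈ s, Complex.canonicalFactor R u ^ (-D u) with hB
  have hBz : ∀ z, B z = ∏ u ∈ s, Complex.canonicalFactor R u z ^ (-D u) := fun z ↦ by simp [hB]
  have hDneg : ∀ u, (0 : ℝ) ≤ (D⁻ u : ℝ) ∧ -(D u : ℝ) ≤ (D⁻ u : ℝ) := fun u ↦ by
    rw [Function.locallyFinsuppWithin.negPart_apply]
    exact ⟨by exact_mod_cast negPart_nonneg (D u), by exact_mod_cast neg_le_negPart (D u)⟩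
  set H : ℂ → ℝ := fun z ↦
    circleAverage ((Complex.re ∘ herglotzRieszKernel 0 z) * fun ζ ↦ log⁺ ‖g ζ‖) 0 R with hH
  obtain ⟨hHi, hHa⟩ := circleAverage_poisson hplog ht.le htR
  have hsph : ∀ ζ ∈ sphere (0 : ℂ) |R|, ζ ∈ sphere (0 : ℂ) R := by simp [abs_of_pos hR]
  have hH0 : ∀ z ∈ ball (0 : ℂ) R, 0 ≤ H z := fun z hz ↦
    circleAverage_nonneg_of_nonneg fun ζ hζ ↦
      mul_nonneg (re_herglotzRieszKernel_nonneg hz (hsph ζ hζ)) posLog_nonneg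
  have hqH : ∀ z ∈ ball (0 : ℂ) R, log ‖q z‖ ≤ H z := fun z hz ↦ by
    rw [← hP z hz]
    refine circleAverage_mono (hlog.re_herglotzRieszKernel_mul hz)
      (hplog.re_herglotzRieszKernel_mul hz) fun ζ hζ ↦ ?_
    exact mul_le_mul_of_nonneg_left (le_max_right _ _)
      (re_herglotzRieszKernel_nonneg hz (hsph ζ hζ))
  have hpt : ∀ z ∈ ball (0 : ℂ) R, log⁺ ‖B z * q z‖ ≤
      H z + ∑ u ∈ s, (D⁻ u : ℝ) * log ‖Complex.canonicalFactor R u z‖ := by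
    intro z hz
    have hG : ∀ u ∈ s, 0 ≤ log ‖Complex.canonicalFactor R u z‖ := fun u hu ↦
      log_norm_canonicalFactor_nonneg (hmem u hu) hz
    refine max_le (add_nonneg (hH0 z hz)
      (Finset.sum_nonneg fun u hu ↦ mul_nonneg (hDneg u).1 (hG u hu))) ?_
    -- At a zero or pole of `g` the value of `B` is zero by convention, and so is the logarithm.
    by_cases hzs : z ∈ s
    · have : B z = 0 := by
        rw [hBz]
        refine Finset.prod_eq_zero hzs ?_
        rw [Complex.canonicalFactor_apply_self]
        refine zero_zpow _ (neg_ne_zero.2 ?_)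
        simpa [hs] using hzs
      rw [this, zero_mul, norm_zero, log_zero]
      exact add_nonneg (hH0 z hz)
        (Finset.sum_nonneg fun u hu ↦ mul_nonneg (hDneg u).1 (hG u hu))
    · have hcf : ∀ u ∈ s, ‖Complex.canonicalFactor R u z‖ ^ (-D u) ≠ 0 := fun u hu ↦
        zpow_ne_zero _ (norm_ne_zero_iff.2 (Complex.canonicalFactor_ne_zero (hmem u hu)
          (ball_subset_closedBall hz) (by rintro rfl; exact hzs hu)))
      rw [norm_mul, hBz, norm_prod]
      simp_rw [norm_zpow]
      rw [log_mul (Finset.prod_ne_zero_iff.2 hcf) (norm_ne_zero_iff.2 (hq0 z hz)), log_prod hcf,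
        add_comm]
      refine add_le_add (hqH z hz) (Finset.sum_le_sum fun u hu ↦ ?_)
      rw [log_zpow]
      refine mul_le_mul_of_nonneg_right ?_ (hG u hu)
      simpa using (hDneg u).2
  have htsub : sphere (0 : ℂ) |t| ⊆ ball 0 R := by
    rw [abs_of_pos ht]
    exact sphere_subset_closedBall.trans (closedBall_subset_ball htR)
  have hcongr : (fun z ↦ log⁺ ‖g z‖) =ᶠ[codiscreteWithin (sphere (0 : ℂ) |t|)]
      fun z ↦ log⁺ ‖B z * q z‖ := by
    filter_upwards [codiscreteWithin_mono (htsub.trans ball_subset_closedBall) hgq] with z hz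
    rw [hz]
    rfl
  have hgi : CircleIntegrable (fun z ↦ log⁺ ‖g z‖) 0 t :=
    (hg.mono_set (htsub.trans ball_subset_closedBall)).circleIntegrable_posLog_norm
  have hcfi : ∀ u ∈ s, CircleIntegrable
      (fun z ↦ (D⁻ u : ℝ) * log ‖Complex.canonicalFactor R u z‖) 0 t := fun u _ ↦ by
    have : MeromorphicOn (Complex.canonicalFactor R u) (sphere 0 |t|) := fun z _ ↦
      Complex.meromorphic_canonicalFactor R u z
    exact this.circleIntegrable_log_norm.const_mul _
  have hsumi : CircleIntegrable
      (fun z ↦ ∑ u ∈ s, (D⁻ u : ℝ) * log ‖Complex.canonicalFactor R u z‖) 0 t :=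
    CircleIntegrable.fun_sum s hcfi
  rw [circleAverage_congr_codiscreteWithin hcongr ht.ne']
  refine (circleAverage_mono (hgi.congr_codiscreteWithin hcongr) (hHi.add hsumi)
    fun z hz ↦ hpt z (htsub hz)).trans (le_of_eq ?_)
  rw [circleAverage_add hHi hsumi, hHa, circleAverage_fun_sum hcfi]
  congr 1
  refine Finset.sum_congr rfl fun u hu ↦ ?_
  rw [← circleAverage_log_norm_canonicalFactor (hmem u hu) ht htR, ← smul_eq_mul (D⁻ u : ℝ)
    (circleAverage _ _ _), ← circleAverage_fun_smul]
  rfl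

end

/-! ### A monotone variant of the characteristic -/

/-- The sum `∑ log (R / |b|) + n(0, g) log⁺ R` over the nonzero poles `b` of `g` in the closed
disc of radius `R`, counted with multiplicity. It differs from the counting function
`discPoleCounting` in the term at the origin only, and is nonnegative and monotone in `R`. -/
noncomputable def plusPoleCounting (g : ℂ → ℂ) (R : ℝ) : ℝ :=
  ∑ᶠ u : ℂ, ((MeromorphicOn.divisor g (closedBall 0 R))⁻ u : ℝ) * log (R * ‖u‖⁻¹)
    + ((MeromorphicOn.divisor g (closedBall 0 R))⁻ 0 : ℝ) * log⁺ R

/-- The variant of the characteristic with `plusPoleCounting` in place of the counting function. -/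
noncomputable def plusCharacteristic (g : ℂ → ℂ) (R : ℝ) : ℝ :=
  circleAverage (fun z ↦ log⁺ ‖g z‖) 0 R + plusPoleCounting g R

section

variable {g : ℂ → ℂ} {R : ℝ}

theorem Int.negPart_le_abs (n : ℤ) : n⁻ ≤ |n| := by
  rw [negPart_def]
  exact max_le (neg_le_abs n) (abs_nonneg n)

theorem log_mul_inv_norm_nonneg (u : ℂ) (hu : u ∈ closedBall (0 : ℂ) R) :
    0 ≤ log (R * ‖u‖⁻¹) := by
  rcases eq_or_ne u 0 with rfl | hu0
  · simp
  · rw [mem_closedBall_zero_iff] at hu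
    refine log_nonneg ?_
    rw [← div_eq_mul_inv]
    exact (one_le_div (norm_pos_iff.2 hu0)).2 hu

theorem negPart_divisor_nonneg (g : ℂ → ℂ) (U : Set ℂ) (u : ℂ) :
    (0 : ℝ) ≤ ((MeromorphicOn.divisor g U)⁻ u : ℝ) := by
  rw [Function.locallyFinsuppWithin.negPart_apply]
  exact_mod_cast negPart_nonneg _

theorem negPart_divisor_mul_log_nonneg (g : ℂ → ℂ) (R : ℝ) (u : ℂ) :
    0 ≤ ((MeromorphicOn.divisor g (closedBall 0 R))⁻ u : ℝ) * log (R * ‖u‖⁻¹) := by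
  by_cases hu : u ∈ closedBall (0 : ℂ) R
  · exact mul_nonneg (negPart_divisor_nonneg _ _ _) (log_mul_inv_norm_nonneg u hu)
  · simp [Function.locallyFinsuppWithin.apply_eq_zero_of_notMem _ hu]

theorem plusPoleCounting_nonneg (g : ℂ → ℂ) (R : ℝ) : 0 ≤ plusPoleCounting g R :=
  add_nonneg (finsum_nonneg fun u ↦ negPart_divisor_mul_log_nonneg g R u)
    (mul_nonneg (negPart_divisor_nonneg _ _ _) posLog_nonneg)

theorem circleAverage_posLog_nonneg (F : ℂ → ℝ) (R : ℝ) :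
    0 ≤ circleAverage (fun z ↦ log⁺ (F z)) 0 R :=
  circleAverage_nonneg_of_nonneg fun _ _ ↦ posLog_nonneg

theorem plusCharacteristic_nonneg (g : ℂ → ℂ) (R : ℝ) : 0 ≤ plusCharacteristic g R :=
  add_nonneg (circleAverage_posLog_nonneg _ R) (plusPoleCounting_nonneg g R)

/-- The sum over the nonzero poles may be taken over any finite set containing them. -/
theorem finsum_negPart_divisor_mul_log (g : ℂ → ℂ) (R : ℝ) {s : Finset ℂ}
    (hs : (MeromorphicOn.divisor g (closedBall 0 R)).support ⊆ s) :
    ∑ᶠ u : ℂ, ((MeromorphicOn.divisor g (closedBall 0 R))⁻ u : ℝ) * log (R * ‖u‖⁻¹) =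
      ∑ u ∈ s, ((MeromorphicOn.divisor g (closedBall 0 R))⁻ u : ℝ) * log (R * ‖u‖⁻¹) := by
  refine finsum_eq_sum_of_support_subset _ fun u hu ↦ hs fun h0 ↦ hu ?_
  simp [Function.locallyFinsuppWithin.negPart_apply, h0]

theorem plusCharacteristic_le_discCharacteristic_add (hR : 0 < R)
    (hg : MeromorphicOn g (closedBall 0 R)) :
    plusCharacteristic g R ≤ discCharacteristic g R +
      |((meromorphicOrderAt g 0).untop₀ : ℝ)| * log⁺ R⁻¹ := by
  have h0 : (0 : ℂ) ∈ closedBall (0 : ℂ) R := mem_closedBall_self hR.le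
  rw [plusCharacteristic, discCharacteristic, plusPoleCounting, discPoleCounting, abs_of_pos hR]
  have h1 := posLog_sub_posLog_inv (x := R)
  have h2 : ((MeromorphicOn.divisor g (closedBall 0 R))⁻ 0 : ℝ) ≤
      |((meromorphicOrderAt g 0).untop₀ : ℝ)| := by
    rw [Function.locallyFinsuppWithin.negPart_apply, MeromorphicOn.divisor_apply hg h0]
    exact_mod_cast Int.negPart_le_abs _
  have h3 := mul_le_mul_of_nonneg_right h2 (posLog_nonneg (x := R⁻¹))
  rw [← h1]
  linarith

/-- By Jensen's formula the Poisson–Jensen data are controlled by the characteristic. -/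
theorem poissonJensenMass_le (hR : 0 < R) (hg : MeromorphicOn g (closedBall 0 R)) :
    poissonJensenMass g R ≤ 2 * plusCharacteristic g R +
      |((meromorphicOrderAt g 0).untop₀ : ℝ)| * (1 + log⁺ R⁻¹) +
      |log ‖meromorphicTrailingCoeffAt g 0‖| := by
  have h0 : (0 : ℂ) ∈ closedBall (0 : ℂ) R := mem_closedBall_self hR.le
  have hlog := circleIntegrable_log_norm_of_closedBall hR hg
  have hplog := circleIntegrable_posLog_norm_of_closedBall hR hg
  have hJ := MeromorphicOn.circleAverage_log_norm (c := 0) hR.ne'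
    (by rwa [abs_of_pos hR])
  rw [abs_of_pos hR] at hJ
  have hD0 := MeromorphicOn.divisor_apply hg h0
  set D := MeromorphicOn.divisor g (closedBall 0 R) with hD
  have hfin : D.support.Finite := D.finiteSupport (isCompact_closedBall 0 R)
  set s := hfin.toFinset with hs
  have hsupp : D.support ⊆ s := by simp [hs]
  rw [finsum_eq_sum_of_support_subset (s := s) _
    (fun u hu ↦ hsupp fun h0 ↦ hu (by simp [h0]))] at hJ
  simp only [zero_sub, norm_neg] at hJ
  have habs : circleAverage (fun z ↦ |log ‖g z‖|) 0 R =
      2 * circleAverage (fun z ↦ log⁺ ‖g z‖) 0 R - circleAverage (fun z ↦ log ‖g z‖) 0 R := by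
    rw [← smul_eq_mul, ← circleAverage_fun_smul, ← circleAverage_fun_sub
      (CircleIntegrable.const_fun_smul hplog) hlog]
    congr 1
    ext z
    rw [smul_eq_mul, posLog_apply]
    rcases le_total 0 (log ‖g z‖) with h | h
    · rw [abs_of_nonneg h, max_eq_right h]; ring
    · rw [abs_of_nonpos h, max_eq_left h]; ring
  have hterm : ∀ u ∈ s, |(MeromorphicOn.divisor g (ball 0 R) u : ℝ)| * (1 - ‖u‖ / R) ≤
      (if u = 0 then |(D 0 : ℝ)| else 0) + ((D u : ℝ) + 2 * (D⁻ u : ℝ)) * log (R * ‖u‖⁻¹) := by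
    intro u hu
    have huR : u ∈ closedBall (0 : ℂ) R := D.supportWithinDomain (by simpa [hs] using hu)
    have hpart : (D u : ℝ) + 2 * (D⁻ u : ℝ) = |(D u : ℝ)| := by
      rw [Function.locallyFinsuppWithin.negPart_apply]
      have h1 := posPart_add_negPart (D u)
      have h2 := posPart_sub_negPart (D u)
      have : D u + 2 * (D u)⁻ = |D u| := by linarith
      exact_mod_cast this
    rw [hpart]
    by_cases hb : u ∈ ball (0 : ℂ) R
    · have hDb : MeromorphicOn.divisor g (ball 0 R) u = D u := by
        rw [MeromorphicOn.divisor_apply (hg.mono_set ball_subset_closedBall) hb, hD,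
          MeromorphicOn.divisor_apply hg huR]
      rw [hDb]
      rcases eq_or_ne u 0 with rfl | hu0
      · simp
      · have hp : 0 < ‖u‖ := norm_pos_iff.2 hu0
        rw [if_neg hu0, zero_add]
        refine mul_le_mul_of_nonneg_left ?_ (abs_nonneg _)
        -- `1 - ‖u‖ / R ≤ log (R / ‖u‖)`
        have h3 := one_sub_inv_le_log_of_pos (show 0 < R * ‖u‖⁻¹ by positivity)
        rwa [mul_inv, inv_inv, mul_comm, ← div_eq_mul_inv] at h3
    · rw [Function.locallyFinsuppWithin.apply_eq_zero_of_notMem _ hb]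
      simp only [Int.cast_zero, abs_zero, zero_mul]
      refine add_nonneg ?_ (mul_nonneg (abs_nonneg _) (log_mul_inv_norm_nonneg u huR))
      split_ifs
      exacts [abs_nonneg _, le_rfl]
  have hsum : ∑ᶠ u, |(MeromorphicOn.divisor g (ball 0 R) u : ℝ)| * (1 - ‖u‖ / R) ≤
      |(D 0 : ℝ)| + ∑ u ∈ s, (D u : ℝ) * log (R * ‖u‖⁻¹) +
        2 * ∑ u ∈ s, (D⁻ u : ℝ) * log (R * ‖u‖⁻¹) := by
    rw [finsum_eq_sum_of_support_subset (s := s)]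
    · refine (Finset.sum_le_sum hterm).trans ?_
      have hsplit : ∑ u ∈ s, ((D u : ℝ) + 2 * (D⁻ u : ℝ)) * log (R * ‖u‖⁻¹) =
          ∑ u ∈ s, (D u : ℝ) * log (R * ‖u‖⁻¹) + 2 * ∑ u ∈ s, (D⁻ u : ℝ) * log (R * ‖u‖⁻¹) := by
        rw [Finset.mul_sum, ← Finset.sum_add_distrib]
        exact Finset.sum_congr rfl fun u _ ↦ by ring
      rw [Finset.sum_add_distrib, hsplit, add_assoc]
      refine add_le_add ?_ le_rfl
      rw [Finset.sum_ite_eq']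
      split_ifs
      exacts [le_rfl, abs_nonneg _]
    · intro u hu
      refine hsupp fun h0 ↦ hu ?_
      by_cases hb : u ∈ ball (0 : ℂ) R
      · have : MeromorphicOn.divisor g (ball 0 R) u = D u := by
          rw [MeromorphicOn.divisor_apply (hg.mono_set ball_subset_closedBall) hb, hD,
            MeromorphicOn.divisor_apply hg (ball_subset_closedBall hb)]
        simp [this, h0]
      · simp [Function.locallyFinsuppWithin.apply_eq_zero_of_notMem _ hb]
  have hlast : -((D 0 : ℝ) * log R) ≤ 2 * ((D⁻ 0 : ℝ) * log⁺ R) + |(D 0 : ℝ)| * log⁺ R⁻¹ := by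
    rw [← posLog_sub_posLog_inv, Function.locallyFinsuppWithin.negPart_apply]
    have h1 : (((D 0)⁻ : ℤ) : ℝ) = max (-(D 0 : ℝ)) 0 := by
      rw [negPart_def]
      push_cast
      rfl
    have p1 : 0 ≤ log⁺ R := posLog_nonneg
    have p2 : 0 ≤ log⁺ R⁻¹ := posLog_nonneg
    rw [h1]
    have h2 : -(D 0 : ℝ) * log⁺ R ≤ max (-(D 0 : ℝ)) 0 * log⁺ R :=
      mul_le_mul_of_nonneg_right (le_max_left _ _) p1
    have h3 : (D 0 : ℝ) * log⁺ R⁻¹ ≤ |(D 0 : ℝ)| * log⁺ R⁻¹ :=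
      mul_le_mul_of_nonneg_right (le_abs_self _) p2
    have h4 : 0 ≤ max (-(D 0 : ℝ)) 0 * log⁺ R := mul_nonneg (le_max_right _ _) p1
    linarith
  rw [poissonJensenMass, plusCharacteristic, plusPoleCounting,
    finsum_negPart_divisor_mul_log g R hsupp, habs, hJ, ← hD0]
  have := neg_abs_le (log ‖meromorphicTrailingCoeffAt g 0‖)
  linarith

/-- Up to a term from a pole at the origin, the characteristic on an outer circle dominates the
proximity function on inner circles. -/
theorem circleAverage_posLog_norm_le_plusCharacteristic (hg : MeromorphicOn g (closedBall 0 R))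
    (h'g : ∀ u ∈ closedBall (0 : ℂ) R, meromorphicOrderAt g u ≠ ⊤) {t : ℝ} (ht : 0 < t)
    (htR : t < R) :
    circleAverage (fun z ↦ log⁺ ‖g z‖) 0 t ≤ plusCharacteristic g R +
      |((meromorphicOrderAt g 0).untop₀ : ℝ)| * log (R / t) := by
  have hR : 0 < R := ht.trans htR
  have h0 : (0 : ℂ) ∈ ball (0 : ℂ) R := mem_ball_self hR
  refine (circleAverage_posLog_norm_le hg h'g ht htR).trans ?_
  have hmem := fun u ↦ mem_ball_of_mem_divisor_support hg (u := u)
  set s := hg.divisor_ball_support_finite.toFinset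
  have hlogRt : 0 ≤ log (R / t) := log_nonneg ((one_le_div ht).2 htR.le)
  set D := MeromorphicOn.divisor g (closedBall 0 R) with hD
  have hDb : ∀ u ∈ ball (0 : ℂ) R,
      (MeromorphicOn.divisor g (ball 0 R))⁻ u = D⁻ u := fun u hu ↦ by
    rw [Function.locallyFinsuppWithin.negPart_apply, Function.locallyFinsuppWithin.negPart_apply,
      MeromorphicOn.divisor_apply (hg.mono_set ball_subset_closedBall) hu, hD,
      MeromorphicOn.divisor_apply hg (ball_subset_closedBall hu)]
  have hD0 : (D⁻ 0 : ℝ) ≤ |((meromorphicOrderAt g 0).untop₀ : ℝ)| := by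
    rw [Function.locallyFinsuppWithin.negPart_apply, hD,
      MeromorphicOn.divisor_apply hg (ball_subset_closedBall h0)]
    exact_mod_cast Int.negPart_le_abs _
  have hn : ∀ u, (0 : ℝ) ≤ (D⁻ u : ℝ) := negPart_divisor_nonneg g _
  have hterm : ∀ u ∈ s, ((MeromorphicOn.divisor g (ball 0 R))⁻ u : ℝ) *
      (log (R / t) - log⁺ (t⁻¹ * ‖u‖)) ≤
      (if u = 0 then (D⁻ 0 : ℝ) * log (R / t) else 0) + (D⁻ u : ℝ) * log (R * ‖u‖⁻¹) := by
    intro u hu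
    rw [hDb u (hmem u hu)]
    rcases eq_or_ne u 0 with rfl | hu0
    · simp
    · have hp : 0 < ‖u‖ := norm_pos_iff.2 hu0
      rw [if_neg hu0, zero_add]
      refine mul_le_mul_of_nonneg_left ?_ (hn u)
      have h1 : log (t⁻¹ * ‖u‖) ≤ log⁺ (t⁻¹ * ‖u‖) := le_max_right _ _
      rw [log_mul (inv_ne_zero ht.ne') hp.ne', log_inv] at h1
      rw [log_div hR.ne' ht.ne', log_mul hR.ne' (inv_ne_zero hp.ne'), log_inv]
      linarith
  have hfin : D.support.Finite := D.finiteSupport (isCompact_closedBall 0 R)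
  have hsub : s ⊆ hfin.toFinset := by
    intro u hu
    have hu' := hmem u hu
    have : MeromorphicOn.divisor g (ball 0 R) u ≠ 0 := by simpa [s] using hu
    rw [MeromorphicOn.divisor_apply (hg.mono_set ball_subset_closedBall) hu',
      ← MeromorphicOn.divisor_apply hg (ball_subset_closedBall hu'), ← hD] at this
    simpa using this
  have hsum : ∑ u ∈ s, ((MeromorphicOn.divisor g (ball 0 R))⁻ u : ℝ) *
      (log (R / t) - log⁺ (t⁻¹ * ‖u‖)) ≤
      (D⁻ 0 : ℝ) * log (R / t) + ∑ u ∈ hfin.toFinset, (D⁻ u : ℝ) * log (R * ‖u‖⁻¹) := by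
    refine (Finset.sum_le_sum hterm).trans ?_
    rw [Finset.sum_add_distrib]
    refine add_le_add ?_ (Finset.sum_le_sum_of_subset_of_nonneg hsub
      fun u _ _ ↦ negPart_divisor_mul_log_nonneg g R u)
    rw [Finset.sum_ite_eq']
    split_ifs
    exacts [le_rfl, mul_nonneg (hn 0) hlogRt]
  rw [plusCharacteristic, plusPoleCounting,
    finsum_negPart_divisor_mul_log g R (s := hfin.toFinset) (by simp [hD])]
  have h5 := mul_le_mul_of_nonneg_right hD0 hlogRt
  have h6 : 0 ≤ (D⁻ 0 : ℝ) * log⁺ R := mul_nonneg (hn 0) posLog_nonneg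
  linarith

/-- Differentiation at most doubles the multiplicity of a pole. -/
theorem negPart_untop₀_meromorphicOrderAt_deriv_le {u : ℂ} (hg : MeromorphicAt g u)
    (h'g : meromorphicOrderAt g u ≠ ⊤) :
    ((meromorphicOrderAt (deriv g) u).untop₀)⁻ ≤ 2 * ((meromorphicOrderAt g u).untop₀)⁻ := by
  lift meromorphicOrderAt g u to ℤ using h'g with n hn
  rcases lt_or_ge n 0 with h | h
  · rw [meromorphicOrderAt_deriv_eq_sub_one (n := n) (by exact_mod_cast h.ne) hn.symm]
    simp only [WithTop.untop₀_coe]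
    rw [negPart_def, negPart_def]
    change max (-(n - 1)) 0 ≤ 2 * max (-n) 0
    omega
  · have h1 : 0 ≤ meromorphicOrderAt g u := by
      rw [← hn]
      exact_mod_cast h
    obtain ⟨G, hG, hgG⟩ := hg.meromorphicOrderAt_nonneg_iff.1 h1
    have h2 : 0 ≤ meromorphicOrderAt (deriv g) u := by
      rw [meromorphicOrderAt_congr hgG.nhdsNE_deriv]
      exact hG.deriv.meromorphicOrderAt_nonneg
    have h3 : 0 ≤ (meromorphicOrderAt (deriv g) u).untop₀ := by
      cases h4 : meromorphicOrderAt (deriv g) u with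
      | top => simp
      | coe m =>
        rw [h4] at h2
        exact_mod_cast h2
    rw [negPart_eq_zero.2 h3]
    exact mul_nonneg zero_le_two (negPart_nonneg _)

theorem plusPoleCounting_deriv_le (hg : MeromorphicOn g (closedBall 0 R))
    (h'g : ∀ u ∈ closedBall (0 : ℂ) R, meromorphicOrderAt g u ≠ ⊤) {t : ℝ} (ht : 0 < t)
    (htR : t ≤ R) : plusPoleCounting (deriv g) t ≤ 2 * plusPoleCounting g R := by
  have hR : 0 < R := ht.trans_le htR
  have hsub : closedBall (0 : ℂ) t ⊆ closedBall 0 R := closedBall_subset_closedBall htR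
  have hd : MeromorphicOn (deriv g) (closedBall 0 t) := (hg.mono_set hsub).deriv
  set D' := MeromorphicOn.divisor (deriv g) (closedBall 0 t) with hD'
  set D := MeromorphicOn.divisor g (closedBall 0 R) with hD
  have hle : ∀ u, (D'⁻ u : ℝ) ≤ 2 * (D⁻ u : ℝ) := by
    intro u
    by_cases hu : u ∈ closedBall (0 : ℂ) t
    · rw [Function.locallyFinsuppWithin.negPart_apply, Function.locallyFinsuppWithin.negPart_apply,
        hD', hD, MeromorphicOn.divisor_apply hd hu, MeromorphicOn.divisor_apply hg (hsub hu)]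
      exact_mod_cast negPart_untop₀_meromorphicOrderAt_deriv_le (hg u (hsub hu)) (h'g u (hsub hu))
    · rw [Function.locallyFinsuppWithin.apply_eq_zero_of_notMem _ hu]
      simp
  have hf : D.support.Finite := D.finiteSupport (isCompact_closedBall 0 R)
  have hf' : D'.support.Finite := D'.finiteSupport (isCompact_closedBall 0 t)
  rw [plusPoleCounting, plusPoleCounting,
    finsum_negPart_divisor_mul_log _ t (s := hf.toFinset ∪ hf'.toFinset) (by simp [hD']),
    finsum_negPart_divisor_mul_log _ R (s := hf.toFinset ∪ hf'.toFinset) (by simp [hD]), mul_add,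
    Finset.mul_sum]
  refine add_le_add (Finset.sum_le_sum fun u _ ↦ ?_) ?_
  · by_cases hu : u ∈ closedBall (0 : ℂ) t
    · rw [← mul_assoc]
      refine mul_le_mul (hle u) ?_ (log_mul_inv_norm_nonneg u hu)
        ((negPart_divisor_nonneg _ _ _).trans (hle u))
      rcases eq_or_ne u 0 with rfl | hu0
      · simp
      · have hp : 0 < ‖u‖ := norm_pos_iff.2 hu0
        gcongr
    · rw [Function.locallyFinsuppWithin.apply_eq_zero_of_notMem _ hu, Int.cast_zero, zero_mul]
      exact mul_nonneg zero_le_two (negPart_divisor_mul_log_nonneg g R u)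
  · rw [← mul_assoc]
    exact mul_le_mul (hle 0) (posLog_le_posLog ht.le htR) posLog_nonneg
      ((negPart_divisor_nonneg _ _ _).trans (hle 0))

end

/-! ### The logarithmic derivative on a well-chosen circle -/

section

variable {g : ℂ → ℂ} {R : ℝ}

theorem poissonJensenMass_nonneg (g : ℂ → ℂ) (R : ℝ) : 0 ≤ poissonJensenMass g R := by
  refine add_nonneg (circleAverage_nonneg_of_nonneg fun z _ ↦ abs_nonneg _)
    (finsum_nonneg fun u ↦ ?_)
  by_cases hu : u ∈ ball (0 : ℂ) R
  · have hR : 0 < R := pos_of_mem_ball hu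
    refine mul_nonneg (abs_nonneg _) (sub_nonneg.2 ((div_le_one hR).2 ?_))
    exact (mem_ball_zero_iff.1 hu).le
  · simp [Function.locallyFinsuppWithin.apply_eq_zero_of_notMem _ hu]

theorem measurable_indicator_analyticAt (g : ℂ → ℂ) (W : Set ℂ) (hW : IsOpen W) :
    Measurable ((W ∩ {z | AnalyticAt ℂ g z}).indicator g) := by
  classical
  have hV : IsOpen (W ∩ {z | AnalyticAt ℂ g z}) := hW.inter (isOpen_analyticAt ℂ g)
  rw [← piecewise_eq_indicator]
  exact ContinuousOn.measurable_piecewise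
    (fun z hz ↦ hz.2.continuousAt.continuousWithinAt) continuousOn_const hV.measurableSet

/-- A meromorphic function agrees almost everywhere with its restriction to the open set on which it
is analytic. -/
theorem MeromorphicOn.aemeasurable {W : Set ℂ} (hg : MeromorphicOn g W) (hW : IsOpen W) :
    AEMeasurable g (volume.restrict W) := by
  refine ⟨_, measurable_indicator_analyticAt g W hW, ?_⟩
  refine ae_restrict_le_codiscreteWithin hW.measurableSet ?_
  filter_upwards [hg.analyticAt_mem_codiscreteWithin, self_mem_codiscreteWithin W] with z hz hzW
  rw [indicator_of_mem (show z ∈ W ∩ {z | AnalyticAt ℂ g z} from ⟨hzW, hz⟩)]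

theorem posLog_le_mul_add_posLog_inv {δ x : ℝ} (hδ : 0 < δ) (hx : 0 ≤ x) :
    log⁺ x ≤ δ * x + log⁺ δ⁻¹ := by
  have h1 : log⁺ (δ * x * δ⁻¹) ≤ log⁺ (δ * x) + log⁺ δ⁻¹ := posLog_mul
  have h2 : log⁺ (δ * x) ≤ δ * x := max_le (by positivity) (log_le_self (by positivity))
  have h3 : δ * x * δ⁻¹ = x := by field_simp
  rw [h3] at h1
  linarith

theorem circleMap_ae_of_codiscreteWithin {t : ℝ} (ht : t ≠ 0) {p : ℂ → Prop}
    (h : ∀ᶠ z in codiscreteWithin (sphere (0 : ℂ) |t|), p z) :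
    ∀ᵐ θ ∂volume.restrict (Ioo (-π) π), p (circleMap 0 t θ) :=
  ae_restrict_le_codiscreteWithin measurableSet_Ioo
    (codiscreteWithin_mono (subset_univ _) (circleMap_preimage_codiscrete ht h))

/-- On some circle of a given annulus, the proximity function of the logarithmic derivative is
bounded by the Poisson–Jensen data. Since `log⁺ x ≤ δ x + log⁺ (1 / δ)`, the area integral of the
logarithmic derivative over the annulus controls the proximity function in the mean. -/
theorem exists_circleAverage_posLog_logDeriv_le (hg : MeromorphicOn g (closedBall 0 R))
    (h'g : ∀ u ∈ closedBall (0 : ℂ) R, meromorphicOrderAt g u ≠ ⊤) {δ : ℝ} (hδ : 0 < δ)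
    (hδR : R / 2 ≤ R - 2 * δ) :
    ∃ t ∈ Ioo (R - 2 * δ) (R - δ), circleAverage (fun z ↦ log⁺ ‖logDeriv g z‖) 0 t ≤
      40 * poissonJensenMass g R + log⁺ δ⁻¹ := by
  have hR : 0 < R := by linarith
  set M := poissonJensenMass g R with hM
  have hM0 : 0 ≤ M := poissonJensenMass_nonneg g R
  -- Restricting to the points of analyticity makes the logarithmic derivative measurable.
  set V : Set ℂ := ball 0 R ∩ {z | AnalyticAt ℂ g z} with hV
  have hVm : MeasurableSet V := (isOpen_ball.inter (isOpen_analyticAt ℂ g)).measurableSet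
  set F : ℂ → ENNReal := V.indicator fun z ↦ ‖logDeriv g z‖ₑ with hF
  have hFm : Measurable F := by
    have h1 : F = V.indicator fun z ↦ ‖deriv g z / V.indicator g z‖ₑ := by
      refine indicator_congr fun z hz ↦ ?_
      rw [indicator_of_mem hz, logDeriv_apply]
    rw [h1]
    exact (((measurable_deriv g).div
      (measurable_indicator_analyticAt g _ isOpen_ball)).enorm).indicator hVm
  have hL : annulusLog R (R - 2 * δ) (R - δ) ≤ 2 := by
    rw [annulusLog_eq (by linarith) (by linarith)]
    have : (R - (R - 2 * δ)) / (R - (R - δ)) = 2 := by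
      rw [div_eq_iff (by linarith)]
      ring
    rw [this]
    linarith [log_two_lt_d9]
  have hA : ∫⁻ t in Ioo (R - 2 * δ) (R - δ), ENNReal.ofReal t * circleLIntegral F t ≤
      ENNReal.ofReal (40 * π * R * M) := by
    rw [← lintegral_annulus hFm (by linarith)]
    refine (lintegral_mono fun z ↦ indicator_le_self _ _ z).trans
      ((lintegral_annulus_logDeriv_le hg h'g (by linarith) (by linarith) (by linarith)).trans
        (ENNReal.ofReal_le_ofReal ?_))
    have : 0 ≤ 20 * π * R * M := by positivity
    nlinarith
  have hvol : volume (Ioo (R - 2 * δ) (R - δ)) = ENNReal.ofReal δ := by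
    rw [Real.volume_Ioo]
    congr 1
    ring
  obtain ⟨t, ht, hle⟩ := exists_le_setLAverage (μ := volume) (s := Ioo (R - 2 * δ) (R - δ))
    (f := fun t ↦ ENNReal.ofReal t * circleLIntegral F t) (by simp [hvol, hδ])
    (by simp [hvol]) (((ENNReal.measurable_ofReal).mul
      (measurable_circleLIntegral hFm)).aemeasurable)
  refine ⟨t, ht, ?_⟩
  have ht0 : 0 < t := by linarith [ht.1]
  have hδ0 : ENNReal.ofReal δ ≠ 0 := by simpa using hδ
  rw [setLAverage_eq, hvol] at hle
  have h2 : ENNReal.ofReal δ * circleLIntegral F t ≤ ENNReal.ofReal (80 * π * M) := by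
    have hR2 : 0 < R / 2 := by positivity
    have h3 : ENNReal.ofReal (R / 2) * (ENNReal.ofReal δ * circleLIntegral F t) ≤
        ENNReal.ofReal (R / 2) * ENNReal.ofReal (80 * π * M) := by
      calc ENNReal.ofReal (R / 2) * (ENNReal.ofReal δ * circleLIntegral F t)
          ≤ ENNReal.ofReal t * (ENNReal.ofReal δ * circleLIntegral F t) := by
            gcongr
            linarith [ht.1]
        _ = (ENNReal.ofReal t * circleLIntegral F t) * ENNReal.ofReal δ := by ring
        _ ≤ ENNReal.ofReal (40 * π * R * M) :=
            (ENNReal.le_div_iff_mul_le (.inl hδ0) (.inl ENNReal.ofReal_ne_top)).1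
              (hle.trans (ENNReal.div_le_div_right hA _))
        _ = ENNReal.ofReal (R / 2) * ENNReal.ofReal (80 * π * M) := by
            rw [← ENNReal.ofReal_mul hR2.le]
            congr 1
            ring
    exact (ENNReal.mul_le_mul_iff_right (by simpa using hR2) ENNReal.ofReal_ne_top).1 h3
  have htsub : sphere (0 : ℂ) |t| ⊆ ball 0 R := by
    rw [abs_of_pos ht0]
    exact sphere_subset_closedBall.trans (closedBall_subset_ball (by linarith [ht.2]))
  have hmer : MeromorphicOn (logDeriv g) (sphere 0 |t|) := by
    have := hg.mono_set (htsub.trans ball_subset_closedBall)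
    exact this.deriv.div this
  have hVae : ∀ᶠ z in codiscreteWithin (sphere (0 : ℂ) |t|), z ∈ V := by
    filter_upwards [codiscreteWithin_mono (htsub.trans ball_subset_closedBall)
      hg.analyticAt_mem_codiscreteWithin, self_mem_codiscreteWithin _] with z hz hz'
    exact ⟨htsub hz', hz⟩
  have h4 : ENNReal.ofReal (2 * π * circleAverage (fun z ↦ log⁺ ‖logDeriv g z‖) 0 t) ≤
      ENNReal.ofReal (80 * π * M + 2 * π * log⁺ δ⁻¹) := by
    have hp : 0 ≤ log⁺ δ⁻¹ := posLog_nonneg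
    rw [← circleLIntegral_ofReal hmer.circleIntegrable_posLog_norm fun _ _ ↦ posLog_nonneg]
    calc circleLIntegral (fun z ↦ ENNReal.ofReal (log⁺ ‖logDeriv g z‖)) t
        ≤ ∫⁻ θ in Ioo (-π) π, (ENNReal.ofReal δ * F (circleMap 0 t θ) +
            ENNReal.ofReal (log⁺ δ⁻¹)) := by
          refine lintegral_mono_ae ?_
          filter_upwards [circleMap_ae_of_codiscreteWithin ht0.ne' hVae] with θ hθ
          rw [hF, indicator_of_mem hθ, ← ofReal_norm, ← ENNReal.ofReal_mul hδ.le,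
            ← ENNReal.ofReal_add (by positivity) hp]
          exact ENNReal.ofReal_le_ofReal (posLog_le_mul_add_posLog_inv hδ (norm_nonneg _))
      _ = ENNReal.ofReal δ * circleLIntegral F t +
            ENNReal.ofReal (log⁺ δ⁻¹) * ENNReal.ofReal (2 * π) := by
          rw [lintegral_add_right _ measurable_const,
            lintegral_const_mul' _ _ ENNReal.ofReal_ne_top, setLIntegral_const, Real.volume_Ioo,
            sub_neg_eq_add, ← two_mul]
          rfl
      _ ≤ ENNReal.ofReal (80 * π * M) + ENNReal.ofReal (log⁺ δ⁻¹) * ENNReal.ofReal (2 * π) := by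
          gcongr
      _ = ENNReal.ofReal (80 * π * M + 2 * π * log⁺ δ⁻¹) := by
          rw [← ENNReal.ofReal_mul hp, ← ENNReal.ofReal_add (by positivity) (by positivity)]
          congr 1
          ring
  have hp : 0 ≤ log⁺ δ⁻¹ := posLog_nonneg
  rw [ENNReal.ofReal_le_ofReal_iff (by positivity)] at h4
  nlinarith [pi_pos]

/-- Passing to the derivative, on a suitable smaller circle. -/
theorem exists_plusCharacteristic_deriv_le (hg : MeromorphicOn g (closedBall 0 R))
    (h'g : ∀ u ∈ closedBall (0 : ℂ) R, meromorphicOrderAt g u ≠ ⊤) {δ : ℝ} (hδ : 0 < δ)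
    (hδR : R / 2 ≤ R - 2 * δ) :
    ∃ t ∈ Ioo (R - 2 * δ) (R - δ), plusCharacteristic (deriv g) t ≤
      (83 + 41 * |((meromorphicOrderAt g 0).untop₀ : ℝ)| +
        40 * |log ‖meromorphicTrailingCoeffAt g 0‖|) *
      (1 + plusCharacteristic g R + log⁺ δ⁻¹) := by
  have hR : 0 < R := by linarith
  obtain ⟨t, ht, hle⟩ := exists_circleAverage_posLog_logDeriv_le hg h'g hδ hδR
  refine ⟨t, ht, ?_⟩
  have ht0 : 0 < t := by linarith [ht.1]
  have htR : t < R := by linarith [ht.2]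
  have htsub : sphere (0 : ℂ) |t| ⊆ closedBall 0 R := by
    rw [abs_of_pos ht0]
    exact sphere_subset_closedBall.trans (closedBall_subset_closedBall htR.le)
  have hgt := hg.mono_set htsub
  have hmer : MeromorphicOn (logDeriv g) (sphere 0 |t|) := hgt.deriv.div hgt
  have hcongr : (fun z ↦ log⁺ ‖deriv g z‖) =ᶠ[codiscreteWithin (sphere (0 : ℂ) |t|)]
      fun z ↦ log⁺ ‖logDeriv g z * g z‖ := by
    filter_upwards [hgt.eventually_codiscreteWithin_apply_ne_zero fun u hu ↦ h'g u (htsub hu)]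
      with z hz
    rw [logDeriv_apply, div_mul_cancel₀ _ hz]
  have h1 : circleAverage (fun z ↦ log⁺ ‖deriv g z‖) 0 t ≤
      circleAverage (fun z ↦ log⁺ ‖logDeriv g z‖) 0 t +
        circleAverage (fun z ↦ log⁺ ‖g z‖) 0 t := by
    rw [circleAverage_congr_codiscreteWithin hcongr ht0.ne', ← circleAverage_fun_add
      hmer.circleIntegrable_posLog_norm hgt.circleIntegrable_posLog_norm]
    refine circleAverage_mono (hgt.deriv.circleIntegrable_posLog_norm.congr_codiscreteWithin hcongr)
      (hmer.circleIntegrable_posLog_norm.add hgt.circleIntegrable_posLog_norm) fun z _ ↦ ?_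
    rw [norm_mul]
    exact posLog_mul
  have h2 := circleAverage_posLog_norm_le_plusCharacteristic hg h'g ht0 htR
  have h3 := poissonJensenMass_le hR hg
  have h4 := plusPoleCounting_deriv_le hg h'g ht0 htR.le
  have h5 : plusPoleCounting g R ≤ plusCharacteristic g R :=
    le_add_of_nonneg_left (circleAverage_posLog_nonneg _ R)
  have h6 : log (R / t) ≤ 1 := by
    have : R / t ≤ 2 := (div_le_iff₀ ht0).2 (by linarith [ht.1])
    linarith [log_le_log (by positivity) this, log_two_lt_d9]
  have h7 : log⁺ R⁻¹ ≤ log⁺ δ⁻¹ :=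
    posLog_le_posLog (by positivity) (inv_anti₀ hδ (by linarith))
  have h8 : 0 ≤ log⁺ δ⁻¹ := posLog_nonneg
  have h9 := plusCharacteristic_nonneg g R
  have hd : plusCharacteristic (deriv g) t =
      circleAverage (fun z ↦ log⁺ ‖deriv g z‖) 0 t + plusPoleCounting (deriv g) t := rfl
  rw [hd]
  set n := |((meromorphicOrderAt g 0).untop₀ : ℝ)|
  set τ := |log ‖meromorphicTrailingCoeffAt g 0‖|
  have hn : 0 ≤ n := abs_nonneg _
  have hτ : 0 ≤ τ := abs_nonneg _
  have e1 : n * log (R / t) ≤ n := mul_le_of_le_one_right hn h6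
  have e2 : n * (1 + log⁺ R⁻¹) ≤ n * (1 + log⁺ δ⁻¹) := by gcongr
  have e3 := mul_nonneg hn h9
  have e4 := mul_nonneg hτ h9
  have e5 := mul_nonneg hn h8
  have e6 := mul_nonneg hτ h8
  nlinarith

end

/-! ### Higher derivatives -/

section

variable {f : ℂ → ℂ} {U : Set ℂ}

theorem MeromorphicOn.iteratedDeriv_complex (hf : MeromorphicOn f U) (i : ℕ) :
    MeromorphicOn (iteratedDeriv i f) U := by
  induction i with
  | zero => rwa [iteratedDeriv_zero]
  | succ i ih =>
    rw [iteratedDeriv_succ]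
    exact ih.deriv

theorem meromorphicOrderAt_deriv_eq_top {g : ℂ → ℂ} {x : ℂ} (h : meromorphicOrderAt g x = ⊤) :
    meromorphicOrderAt (deriv g) x = ⊤ := by
  rw [meromorphicOrderAt_eq_top_iff] at h ⊢
  have h1 : g =ᶠ[nhdsWithin x {x}ᶜ] fun _ ↦ (0 : ℂ) := h
  filter_upwards [h1.nhdsNE_deriv] with z hz
  rw [hz, deriv_const]

theorem meromorphicOrderAt_iteratedDeriv_eq_top_of_le {x : ℂ} {i k : ℕ} (hik : i ≤ k)
    (h : meromorphicOrderAt (iteratedDeriv i f) x = ⊤) :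
    meromorphicOrderAt (iteratedDeriv k f) x = ⊤ := by
  induction k, hik using Nat.le_induction with
  | base => exact h
  | succ n _ ih =>
    rw [iteratedDeriv_succ]
    exact meromorphicOrderAt_deriv_eq_top ih

theorem posLog_two_mul_le (x : ℝ) : log⁺ (2 * x) ≤ 1 + log⁺ x := by
  have h1 : log⁺ (2 * x) ≤ log⁺ 2 + log⁺ x := posLog_mul
  have h2 : log⁺ (2 : ℝ) = log 2 := posLog_eq_log (by norm_num)
  linarith [log_two_lt_d9]

/-- The characteristic of a derivative is controlled by that of `f`, at the price of moving to some
nearby smaller radius. -/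
theorem exists_plusCharacteristic_iteratedDeriv_le (hf : MeromorphicOn f U) {k : ℕ}
    (h : ∀ u ∈ U, meromorphicOrderAt (iteratedDeriv k f) u ≠ ⊤) {i : ℕ} (hik : i ≤ k) :
    ∃ C > 0, ∀ R s : ℝ, closedBall (0 : ℂ) R ⊆ U → R / 2 ≤ s → s < R →
      ∃ ρ ∈ Ioc s R, plusCharacteristic (iteratedDeriv i f) ρ ≤
        C * (1 + log⁺ (1 / (R - s)) + max (discCharacteristic f R) 0) := by
  induction i with
  | zero =>
    set n := |((meromorphicOrderAt f 0).untop₀ : ℝ)| with hn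
    have hn0 : 0 ≤ n := abs_nonneg _
    refine ⟨1 + n, by positivity, fun R s hRU hs hsR ↦ ⟨R, ⟨hsR, le_rfl⟩, ?_⟩⟩
    have hR : 0 < R := by linarith
    have h1 := plusCharacteristic_le_discCharacteristic_add hR (hf.mono_set hRU)
    have h2 : log⁺ R⁻¹ ≤ log⁺ (1 / (R - s)) := by
      rw [one_div]
      exact posLog_le_posLog (by positivity) (inv_anti₀ (by linarith) (by linarith))
    have h3 := le_max_left (discCharacteristic f R) 0
    have h4 := le_max_right (discCharacteristic f R) 0
    have h5 : 0 ≤ log⁺ (1 / (R - s)) := posLog_nonneg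
    rw [iteratedDeriv_zero]
    nlinarith [mul_nonneg hn0 h4, mul_le_mul_of_nonneg_left h2 hn0]
  | succ i ih =>
    obtain ⟨C, hC, hCb⟩ := ih (by omega)
    set g := iteratedDeriv i f with hg
    set K := 83 + 41 * |((meromorphicOrderAt g 0).untop₀ : ℝ)| +
      40 * |log ‖meromorphicTrailingCoeffAt g 0‖| with hK
    have hK0 : 0 < K := by positivity
    refine ⟨K * (2 * C + 3), by positivity, fun R s hRU hs hsR ↦ ?_⟩
    -- Half of the gap between `s` and `R` is spent on the induction hypothesis, the other half on
    -- differentiating.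
    obtain ⟨ρ, hρ, hle⟩ := hCb R ((s + R) / 2) hRU (by linarith) (by linarith)
    have hρU : closedBall (0 : ℂ) ρ ⊆ U := (closedBall_subset_closedBall hρ.2).trans hRU
    obtain ⟨t, ht, htle⟩ := exists_plusCharacteristic_deriv_le (R := ρ) (δ := (R - s) / 4)
      ((hf.iteratedDeriv_complex i).mono_set hρU)
      (fun u hu htop ↦ h u (hρU hu) (meromorphicOrderAt_iteratedDeriv_eq_top_of_le (by omega) htop))
      (by linarith) (by linarith [hρ.1])
    refine ⟨t, ⟨by linarith [ht.1, hρ.1], by linarith [ht.2, hρ.2]⟩, ?_⟩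
    rw [iteratedDeriv_succ, mul_assoc]
    refine htle.trans (mul_le_mul_of_nonneg_left ?_ hK0.le)
    have e1 : (1 : ℝ) / (R - (s + R) / 2) = 2 * (1 / (R - s)) := by
      have : R - s ≠ 0 := by linarith
      rw [show R - (s + R) / 2 = (R - s) / 2 by ring]
      field_simp
    have e2 : ((R - s) / 4)⁻¹ = 2 * (2 * (1 / (R - s))) := by
      have : R - s ≠ 0 := by linarith
      field_simp
      norm_num
    rw [e1] at hle
    rw [e2]
    have h1 := posLog_two_mul_le (1 / (R - s))
    have h2 := posLog_two_mul_le (2 * (1 / (R - s)))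
    have h4 := le_max_right (discCharacteristic f R) 0
    have h5 : 0 ≤ log⁺ (1 / (R - s)) := posLog_nonneg
    set T := max (discCharacteristic f R) 0
    set l := log⁺ (1 / (R - s))
    have h6 := hle.trans (mul_le_mul_of_nonneg_left
      (show 1 + log⁺ (2 * (1 / (R - s))) + T ≤ 2 * (1 + l + T) by linarith) hC.le)
    linarith

/-- The estimate for a single logarithmic derivative, in terms of the characteristic of `f`. -/
theorem exists_lintegral_annulus_logDeriv_iteratedDeriv_le (hf : MeromorphicOn f U) {k : ℕ}
    (h : ∀ u ∈ U, meromorphicOrderAt (iteratedDeriv k f) u ≠ ⊤) {i : ℕ} (hik : i ≤ k) :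
    ∃ C > 0, ∀ R r' r : ℝ, closedBall (0 : ℂ) R ⊆ U → 0 ≤ r' → r' < r → r < R →
      ∫⁻ z in annulus r' r, ‖logDeriv (iteratedDeriv i f) z‖ₑ ≤
        ENNReal.ofReal (C * (R * annulusLog R r' r *
          (1 + log⁺ (1 / (R - r)) + max (discCharacteristic f R) 0))) := by
  obtain ⟨C, hC, hCb⟩ := exists_plusCharacteristic_iteratedDeriv_le hf h hik
  set g := iteratedDeriv i f with hg
  set n := |((meromorphicOrderAt g 0).untop₀ : ℝ)| with hn
  set τ := |log ‖meromorphicTrailingCoeffAt g 0‖| with hτ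
  have hn0 : 0 ≤ n := abs_nonneg _
  have hτ0 : 0 ≤ τ := abs_nonneg _
  refine ⟨40 * π * (4 * C + 2 * n + τ), by positivity, fun R r' r hRU hr' hr'r hrR ↦ ?_⟩
  obtain ⟨ρ, hρ, hle⟩ := hCb R ((R + r) / 2) hRU (by linarith) (by linarith)
  have hρ0 : 0 < ρ := by linarith [hρ.1]
  have hrρ : r < ρ := by linarith [hρ.1]
  have hρU : closedBall (0 : ℂ) ρ ⊆ U := (closedBall_subset_closedBall hρ.2).trans hRU
  have hgρ := (hf.iteratedDeriv_complex i).mono_set hρU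
  refine (lintegral_annulus_logDeriv_le hgρ
    (fun u hu htop ↦ h u (hρU hu) (meromorphicOrderAt_iteratedDeriv_eq_top_of_le hik htop))
    hr' hr'r hrρ).trans (ENNReal.ofReal_le_ofReal ?_)
  have hmass := poissonJensenMass_le hρ0 hgρ
  have e1 : (1 : ℝ) / (R - (R + r) / 2) = 2 * (1 / (R - r)) := by
    have : R - r ≠ 0 := by linarith
    rw [show R - (R + r) / 2 = (R - r) / 2 by ring]
    field_simp
  have h1 := posLog_two_mul_le (1 / (R - r))
  have h2 : log⁺ ρ⁻¹ ≤ log⁺ (2 * (1 / (R - r))) := by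
    refine posLog_le_posLog (by positivity) ?_
    rw [← e1, one_div]
    exact inv_anti₀ (by linarith) (by linarith [hρ.1])
  have h4 := le_max_right (discCharacteristic f R) 0
  have h5 : 0 ≤ log⁺ (1 / (R - r)) := posLog_nonneg
  rw [e1] at hle
  set Q := 1 + log⁺ (1 / (R - r)) + max (discCharacteristic f R) 0 with hQ
  have hQ1 : 1 ≤ Q := by linarith
  have h6 : plusCharacteristic g ρ ≤ C * (2 * Q) :=
    hle.trans (mul_le_mul_of_nonneg_left (by linarith) hC.le)
  have h7 : n * (1 + log⁺ ρ⁻¹) ≤ n * (2 * Q) := by gcongr; linarith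
  have h8 : τ ≤ τ * Q := le_mul_of_one_le_right hτ0 hQ1
  have hM : poissonJensenMass g ρ ≤ (4 * C + 2 * n + τ) * Q := by linarith
  have hL : annulusLog ρ r' r ≤ 2 * annulusLog R r' r := by
    have hL1 := one_le_annulusLog hr'r hrR
    rw [annulusLog_eq hr'r hrR] at hL1 ⊢
    rw [annulusLog_eq hr'r hrρ]
    have hq : 0 < (R - r') / (R - r) := div_pos (by linarith) (by linarith)
    have hq' : (ρ - r') / (ρ - r) ≤ 2 * ((R - r') / (R - r)) := by
      rw [← mul_div_assoc, div_le_div_iff₀ (by linarith) (by linarith)]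
      nlinarith [hρ.1, hρ.2]
    have h9 := log_le_log (div_pos (by linarith) (by linarith)) hq'
    rw [log_mul two_ne_zero hq.ne'] at h9
    linarith [log_two_lt_d9]
  have hL0 := one_le_annulusLog hr'r hrρ
  have hM0 := poissonJensenMass_nonneg g ρ
  calc 20 * π * ρ * annulusLog ρ r' r * poissonJensenMass g ρ
      ≤ 20 * π * R * (2 * annulusLog R r' r) * ((4 * C + 2 * n + τ) * Q) := by
        have hR0 : 0 ≤ R := by linarith
        have hLR := one_le_annulusLog hr'r hrR
        gcongr
        exact hρ.2
    _ = 40 * π * (4 * C + 2 * n + τ) * (R * annulusLog R r' r * Q) := by ring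

/-- A quotient of derivatives factors into logarithmic derivatives, so its root of the
corresponding order is at most their sum. -/
theorem norm_iteratedDeriv_div_rpow_le {j k : ℕ} (hjk : j < k) {z : ℂ}
    (hz : ∀ i ∈ Finset.Ico j k, iteratedDeriv i f z ≠ 0) :
    ‖iteratedDeriv k f z / iteratedDeriv j f z‖ ^ (1 / ((k : ℝ) - (j : ℝ))) ≤
      ∑ i ∈ Finset.Ico j k, ‖logDeriv (iteratedDeriv i f) z‖ := by
  have htel : ∀ m, j ≤ m → m ≤ k → iteratedDeriv m f z =
      iteratedDeriv j f z * ∏ i ∈ Finset.Ico j m, logDeriv (iteratedDeriv i f) z := by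
    intro m hjm
    induction m, hjm using Nat.le_induction with
    | base => simp
    | succ m hjm ih =>
      intro hmk
      rw [Finset.prod_Ico_succ_top hjm, ← mul_assoc, ← ih (by omega), logDeriv_apply,
        mul_div_cancel₀ _ (hz m (Finset.mem_Ico.2 ⟨hjm, hmk⟩)), iteratedDeriv_succ]
  set S := ∑ i ∈ Finset.Ico j k, ‖logDeriv (iteratedDeriv i f) z‖ with hS
  have hS0 : 0 ≤ S := Finset.sum_nonneg fun i _ ↦ norm_nonneg _
  have h1 : ‖iteratedDeriv k f z / iteratedDeriv j f z‖ ≤ S ^ (k - j) := by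
    rw [htel k hjk.le le_rfl, mul_div_cancel_left₀ _ (hz j (Finset.mem_Ico.2 ⟨le_rfl, hjk⟩)),
      norm_prod]
    refine (Finset.prod_le_prod (fun i _ ↦ norm_nonneg _) fun i hi ↦
      Finset.single_le_sum (f := fun i ↦ ‖logDeriv (iteratedDeriv i f) z‖)
        (fun i _ ↦ norm_nonneg _) hi).trans_eq ?_
    rw [Finset.prod_const, Nat.card_Ico]
  rw [one_div, ← Nat.cast_sub hjk.le]
  calc _ ≤ (S ^ (k - j)) ^ (((k - j : ℕ) : ℝ)⁻¹) := by gcongr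
    _ = S := Real.pow_rpow_inv_natCast hS0 (by omega)

end

theorem mainTheorem6 (U : Set ℂ) (hU : IsOpen U) (hUc : IsConnected U)
    (f : ℂ → ℂ) (hf : MeromorphicOn f U) (j k : ℕ) (hjk : j < k)
    (hfj : ¬ iteratedDeriv j f =ᶠ[codiscreteWithin U] 0) :
    ∃ C : ℝ, 0 < C ∧ ∀ R r' r : ℝ, closedBall (0 : ℂ) R ⊆ U → 0 ≤ r' → r' < r → r < R →
      IntegrableOn
        (fun z : ℂ ↦ ‖iteratedDeriv k f z / iteratedDeriv j f z‖ ^ (1 / ((k : ℝ) - (j : ℝ))))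
        {z : ℂ | r' < ‖z‖ ∧ ‖z‖ < r} volume ∧
      ∫ z in {z : ℂ | r' < ‖z‖ ∧ ‖z‖ < r},
          ‖iteratedDeriv k f z / iteratedDeriv j f z‖ ^ (1 / ((k : ℝ) - (j : ℝ))) ≤
        C * (R * log (exp 1 * (R - r') / (R - r)) *
          (1 + log⁺ (1 / (R - r)) + max (discCharacteristic f R) 0)) := by
  have hmeas : ∀ i, AEMeasurable (iteratedDeriv i f) (volume.restrict U) := fun i ↦
    (hf.iteratedDeriv_complex i).aemeasurable hU
  set E := fun z : ℂ ↦
    ‖iteratedDeriv k f z / iteratedDeriv j f z‖ ^ (1 / ((k : ℝ) - (j : ℝ))) with hE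
  have hE0 : ∀ z, 0 ≤ E z := fun z ↦ rpow_nonneg (norm_nonneg _) _
  have hsub : ∀ R r' r : ℝ, closedBall (0 : ℂ) R ⊆ U → r < R → annulus r' r ⊆ U :=
    fun R r' r hRU hrR z hz ↦ hRU (mem_closedBall_zero_iff.2 (hz.2.le.trans hrR.le))
  -- It suffices to bound the lower integral.
  suffices hsuff : ∃ C : ℝ, 0 < C ∧ ∀ R r' r : ℝ, closedBall (0 : ℂ) R ⊆ U → 0 ≤ r' → r' < r →
      r < R → ∫⁻ z in annulus r' r, ENNReal.ofReal (E z) ≤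
        ENNReal.ofReal (C * (R * annulusLog R r' r *
          (1 + log⁺ (1 / (R - r)) + max (discCharacteristic f R) 0))) by
    obtain ⟨C, hC, hCb⟩ := hsuff
    refine ⟨C, hC, fun R r' r hRU hr' hr'r hrR ↦ ?_⟩
    have hle := hCb R r' r hRU hr' hr'r hrR
    have hm : AEStronglyMeasurable E (volume.restrict (annulus r' r)) :=
      ((((hmeas k).div (hmeas j)).norm.pow_const _).mono_measure
        (Measure.restrict_mono (hsub R r' r hRU hrR) le_rfl)).aestronglyMeasurable
    have hnn : 0 ≤ C * (R * annulusLog R r' r *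
        (1 + log⁺ (1 / (R - r)) + max (discCharacteristic f R) 0)) := by
      have h1 : 0 ≤ R := by linarith
      have h2 := one_le_annulusLog hr'r hrR
      have h3 : 0 ≤ log⁺ (1 / (R - r)) := posLog_nonneg
      positivity
    refine ⟨⟨hm, ?_⟩, ?_⟩
    · rw [hasFiniteIntegral_iff_ofReal (Eventually.of_forall hE0)]
      exact hle.trans_lt ENNReal.ofReal_lt_top
    · change ∫ z in annulus r' r, E z ≤ _
      rw [integral_eq_lintegral_of_nonneg_ae (Eventually.of_forall hE0) hm]
      exact ENNReal.toReal_le_of_le_ofReal hnn hle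
  by_cases hk : ∃ u : U, meromorphicOrderAt (iteratedDeriv k f) u ≠ ⊤
  · have h : ∀ u ∈ U, meromorphicOrderAt (iteratedDeriv k f) u ≠ ⊤ := fun u hu ↦
      ((hf.iteratedDeriv_complex k).exists_meromorphicOrderAt_ne_top_iff_forall hUc).1 hk ⟨u, hu⟩
    have hex := fun i : ℕ ↦ exists_lintegral_annulus_logDeriv_iteratedDeriv_le (i := i) hf h
    choose! C hC hCb using hex
    have hne : (Finset.Ico j k).Nonempty := Finset.nonempty_Ico.2 hjk
    refine ⟨∑ i ∈ Finset.Ico j k, C i,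
      Finset.sum_pos (fun i hi ↦ hC i (Finset.mem_Ico.1 hi).2.le) hne,
      fun R r' r hRU hr' hr'r hrR ↦ ?_⟩
    have hmono : volume.restrict (annulus r' r) ≤ volume.restrict U :=
      Measure.restrict_mono (hsub R r' r hRU hrR) le_rfl
    have hae : ∀ᵐ z ∂volume.restrict (annulus r' r),
        ∀ i ∈ Finset.Ico j k, iteratedDeriv i f z ≠ 0 := by
      refine ae_mono hmono (ae_restrict_le_codiscreteWithin hU.measurableSet ?_)
      refine (eventually_all_finset _).2 fun i hi ↦ ?_
      exact (hf.iteratedDeriv_complex i).eventually_codiscreteWithin_apply_ne_zero fun u hu htop ↦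
        h u hu (meromorphicOrderAt_iteratedDeriv_eq_top_of_le (Finset.mem_Ico.1 hi).2.le htop)
    have hnn : 0 ≤ R * annulusLog R r' r *
        (1 + log⁺ (1 / (R - r)) + max (discCharacteristic f R) 0) := by
      have h1 : 0 ≤ R := by linarith
      have h2 := one_le_annulusLog hr'r hrR
      have h3 : 0 ≤ log⁺ (1 / (R - r)) := posLog_nonneg
      positivity
    calc ∫⁻ z in annulus r' r, ENNReal.ofReal (E z)
        ≤ ∫⁻ z in annulus r' r,
            ∑ i ∈ Finset.Ico j k, ‖logDeriv (iteratedDeriv i f) z‖ₑ := by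
          refine lintegral_mono_ae (hae.mono fun z hz ↦ ?_)
          refine (ENNReal.ofReal_le_ofReal (norm_iteratedDeriv_div_rpow_le hjk hz)).trans_eq ?_
          rw [ENNReal.ofReal_sum_of_nonneg fun i _ ↦ norm_nonneg _]
          simp only [ofReal_norm]
      _ = ∑ i ∈ Finset.Ico j k, ∫⁻ z in annulus r' r, ‖logDeriv (iteratedDeriv i f) z‖ₑ := by
          refine lintegral_finsetSum' _ fun i _ ↦ AEMeasurable.enorm ?_
          have hd := hmeas (i + 1)
          rw [iteratedDeriv_succ] at hd
          exact (hd.div (hmeas i)).mono_measure hmono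
      _ ≤ ∑ i ∈ Finset.Ico j k, ENNReal.ofReal (C i * (R * annulusLog R r' r *
            (1 + log⁺ (1 / (R - r)) + max (discCharacteristic f R) 0))) :=
          Finset.sum_le_sum fun i hi ↦
            hCb i (Finset.mem_Ico.1 hi).2.le R r' r hRU hr' hr'r hrR
      _ = _ := by
          rw [Finset.sum_mul, ENNReal.ofReal_sum_of_nonneg fun i hi ↦
            mul_nonneg (hC i (Finset.mem_Ico.1 hi).2.le).le hnn]
  -- Here the derivative of order `k` vanishes identically, so the integrand is zero.
  · push Not at hk
    refine ⟨1, one_pos, fun R r' r hRU hr' hr'r hrR ↦ ?_⟩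
    have hz : ∀ᶠ z in codiscreteWithin U, iteratedDeriv k f z = 0 := by
      refine mem_codiscreteWithin_iff_forall_mem_nhdsNE.2 fun x hx ↦ ?_
      filter_upwards [meromorphicOrderAt_eq_top_iff.1 (hk ⟨x, hx⟩)] with z hz using Or.inl hz
    have hae : ∀ᵐ z ∂volume.restrict (annulus r' r), iteratedDeriv k f z = 0 :=
      ae_mono (Measure.restrict_mono (hsub R r' r hRU hrR) le_rfl)
        (ae_restrict_le_codiscreteWithin hU.measurableSet hz)
    have hexp : 1 / ((k : ℝ) - (j : ℝ)) ≠ 0 :=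
      one_div_ne_zero (sub_pos.2 (Nat.cast_lt.2 hjk)).ne'
    rw [lintegral_congr_ae (g := fun _ ↦ 0) (hae.mono fun z hz ↦ ?_), lintegral_zero]
    · exact zero_le
    · simp only [hE, hz, zero_div, norm_zero, zero_rpow hexp, ENNReal.ofReal_zero]
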